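/- Consider a bandit with $K\ge 2$ arms. In round $t\ge1$ arm $i$ has a reward $X_t(i)\in[0,B]$ (a.s., $B>0$) with mean $\mu_t(i)$; the reward vectors $(X_t(1),\dots,X_t(K))$, $t\ge1$, are independent, and their laws may change with $t$. Put $\mu_t(*)=\max_j\mu_t(j)$ and call arm $i$ optimal in round $t$ if $\mu_t(i)=\mu_t(*)$. Let $\Upsilon_T$ be the number of $t\in\{1,\dots,T-1\}$ such that the law of $X_{t+1}(i)$ differs from that of $X_t(i)$ for some arm $i$ (breakpoints). For $\gamma\in(0,1)$ and $\xi>1/2$, let $I_t$ be the arm played in round $t$ and put $$N_t(\gamma,i)=\sum_{s=1}^t\gamma^{t-s}\mathbf 1\{I_s=i\},\qquad n_t(\gamma)=\sum_{i=1}^K N_t(\gamma,i)=\sum_{s=1}^t\gamma^{t-s},$$ $$\bar X_t(\gamma,i)=\frac1{N_t(\gamma,i)}\sum_{s=1}^t\gamma^{t-s}X_s(i)\mathbf 1\{I_s=i\},\qquad c_t(\gamma,i)=2B\sqrt{\frac{\xi\log n_t(\gamma)}{N_t(\gamma,i)}}.$$ The Discounted UCB policy plays $I_t=t$ for $1\le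 t\le K$ and, for $t\ge K$, an arm $I_{t+1}$ that maximizes $\bar X_t(\gamma,i)+c_t(\gamma,i)$ over $i$, with ties broken by any rule depending only on past rewards. Let $\tilde N_T(i)$ be the number of rounds $t\le T$ in which arm $i$ is played while it is not optimal, and let $\Delta\mu_T(i)=\min\{\mu_t(*)-\mu_t(i):1\le t\le T,\ \mu_t(i)<\mu_t(*)\}$ (if this set is empty, the term containing $\Delta\mu_T(i)$ below is read as $0$). (1) For all $\xi>1/2$, $\gamma\in(0,1)$, $T\ge1$ and every arm $i$, $$\mathbb E[\tilde N_T(i)]\le \mathrm B(\gamma)\,T(1-\gamma)\log\frac1{1-\gamma}+\max(\mathrm C(\gamma),0)\,\frac{\Upsilon_T}{1-\gamma}\log\frac1{1-\gamma},$$ where $$\mathrm B(\gamma)=\frac{16B^2\xi}{\gamma^{1/(1-\gamma)}(\Delta\mu_T(i))^2}\,\frac{\lceil T(1-\gamma)\rceil}{T(1-\gamma)}+\frac{2\left\lceil-\log(1-\gamma)/\log\bigl(1+4\sqrt{1-1/(2\xi)}\bigr)\right\rceil}{-\log(1-\gamma)\,\bigl(1-\gamma^{1/(1-\gamma)}\bigr)},$$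 $$\mathrm C(\gamma)=\frac{\gamma-1}{\log(1-\gamma)\log\gamma}\,\log\bigl((1-\gamma)\,\xi\log n_K(\gamma)\bigr).$$ Note that $\mathrm C(\gamma)\ge0$ if and only if $(1-\gamma)\,\xi\log n_K(\gamma)\le1$. (2) For all $B>0$, $\xi>1/2$, $\delta>0$ there is a constant $C>0$ such that the following holds for all $K$, $T$ and all environments as above with $\Upsilon_T\ge1$, when the policy is run with $\gamma=1-\frac1{4B}\sqrt{\Upsilon_T/T}$ and this $\gamma$ is positive. For every arm $i$ such that $\mu_t(*)-\mu_t(i)\ge\delta$ in every round $t\le T$ in which it is not optimal, $\mathbb E[\tilde N_T(i)]\le C\sqrt{T\Upsilon_T}\,\log T$. If all arms have this property, then the regret satisfies $$\mathbb E\Bigl[\sum_{t=1}^TX_t(i_t^*)-\sum_{t=1}^TX_t(I_t)\Bigr]\le C\,K\sqrt{T\Upsilon_T}\,\log T$$ for any choice of optimal arms $i^*_t$. -/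

import Mathlib

open MeasureTheory ProbabilityTheory

universe u

noncomputable section

namespace NonStatBandit

variable {K : ℕ}

/-- `n_t(γ) = ∑ s = 1..t, γ ^ (t - s)`. -/
def discTotal (γ : ℝ) (t : ℕ) : ℝ := ∑ s ∈ Finset.Icc 1 t, γ ^ (t - s)

/-- Discounted number of plays `N_t(γ, i)` of arm `i` in rounds `1, …, t`. -/
def discCount (γ : ℝ) {Ω : Type u} (I : ℕ → Ω → Fin K) (t : ℕ) (i : Fin K) (ω : Ω) : ℝ :=
  ∑ s ∈ Finset.Icc 1 t, γ ^ (t - s) * (if I s ω = i then 1 else 0)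

/-- `n_t(γ)` is the sum over the arms of the discounted numbers of plays. -/
theorem sum_discCount (γ : ℝ) {Ω : Type u} (I : ℕ → Ω → Fin K) (t : ℕ) (ω : Ω) :
    ∑ i, discCount γ I t i ω = discTotal γ t := by
  unfold discCount discTotal
  rw [Finset.sum_comm]
  simp

variable {Ω : Type u} [MeasurableSpace Ω]

/-- A non-stationary bandit environment with `K` arms and rewards in `[0, B]`.
`X t i` is the reward of arm `i` in round `t`; rounds are numbered `1, 2, 3, …` (`X 0` is never
used). The reward vectors of different rounds are independent, and their laws may vary with `t`. -/
structure IsEnvironment (B : ℝ) (X : ℕ → Fin K → Ω → ℝ) (P : Measure Ω) : Prop where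
  measurable : ∀ t, 1 ≤ t → ∀ i, Measurable (X t i)
  bounded : ∀ t, 1 ≤ t → ∀ i, ∀ᵐ ω ∂P, X t i ω ∈ Set.Icc 0 B
  indep : iIndepFun (fun (t : ℕ) (ω : Ω) (i : Fin K) => X (t + 1) i ω) P

/-- Expected reward `μ_t(i)`. -/
def mean (X : ℕ → Fin K → Ω → ℝ) (P : Measure Ω) (t : ℕ) (i : Fin K) : ℝ := ∫ ω, X t i ω ∂P

/-- Highest expected reward `μ_t(*)`. -/
def bestMean (X : ℕ → Fin K → Ω → ℝ) (P : Measure Ω) (t : ℕ) : ℝ := ⨆ j, mean X P t j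

open Classical in
/-- `Υ_T`: the number of breakpoints, i.e. of pairs of consecutive rounds `t, t + 1` among
`1, …, T` between which the reward distribution of some arm changes. -/
def numBreakpoints (X : ℕ → Fin K → Ω → ℝ) (P : Measure Ω) (T : ℕ) : ℕ :=
  ((Finset.Ico 1 T).filter (fun t => ∃ i, P.map (X (t + 1) i) ≠ P.map (X t i))).card

/-- `Δμ_T(i)`: the smallest gap `μ_t(*) - μ_t(i)` over the rounds `t ≤ T` in which arm `i` is not
optimal (an infimum over a finite set; it has the junk value `0` if arm `i` is always optimal). -/
def minGap (X : ℕ → Fin K → Ω → ℝ) (P : Measure Ω) (T : ℕ) (i : Fin K) : ℝ :=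
  sInf {d | ∃ t ∈ Finset.Icc 1 T, mean X P t i < bestMean X P t ∧
    d = bestMean X P t - mean X P t i}

open Classical in
/-- `Ñ_T(i)`: the number of rounds `t ≤ T` in which arm `i` is played while it is not optimal. -/
def badPlays (X : ℕ → Fin K → Ω → ℝ) (P : Measure Ω) (I : ℕ → Ω → Fin K) (T : ℕ) (i : Fin K)
    (ω : Ω) : ℝ :=
  ∑ t ∈ Finset.Icc 1 T, if I t ω = i ∧ mean X P t i < bestMean X P t then 1 else 0

/-- Discounted empirical average of the rewards of arm `i` collected in rounds `1, …, t`. -/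
def discMean (γ : ℝ) (X : ℕ → Fin K → Ω → ℝ) (I : ℕ → Ω → Fin K) (t : ℕ) (i : Fin K)
    (ω : Ω) : ℝ :=
  (∑ s ∈ Finset.Icc 1 t, γ ^ (t - s) * X s i ω * (if I s ω = i then 1 else 0)) /
    discCount γ I t i ω

/-- Discounted padding function `c_t(γ, i)`. -/
def padding (B ξ γ : ℝ) (I : ℕ → Ω → Fin K) (t : ℕ) (i : Fin K) (ω : Ω) : ℝ :=
  2 * B * √(ξ * Real.log (∑ j, discCount γ I t j ω) / discCount γ I t i ω)

/-- The σ-algebra generated by all rewards of rounds `1, …, t`. -/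
abbrev past (X : ℕ → Fin K → Ω → ℝ) (t : ℕ) : MeasurableSpace Ω :=
  ⨆ s ∈ Finset.Icc 1 t, ⨆ j, MeasurableSpace.comap (X s j) inferInstance

/-- `I t` is the arm played in round `t` by the discounted UCB policy: rounds `1, …, K` play the
arms one after the other (arm number `t` is the element of `Fin K` with value `t - 1`); the next
rounds play an arm that maximizes the upper confidence bound computed from the previous rounds.
Ties may be broken by any rule, as long as it only looks at past rewards. -/
structure IsDUCB (B ξ γ : ℝ) (X : ℕ → Fin K → Ω → ℝ) (I : ℕ → Ω → Fin K) : Prop where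
  init : ∀ t, 1 ≤ t → t ≤ K → ∀ ω, (I t ω : ℕ) = t - 1
  argmax : ∀ t, K ≤ t → ∀ ω j,
    discMean γ X I t j ω + padding B ξ γ I t j ω ≤
      discMean γ X I t (I (t + 1) ω) ω + padding B ξ γ I t (I (t + 1) ω) ω
  nonanticipating : ∀ t, Measurable[past X t] (I (t + 1))

/-- `B(γ)`, as a function of `B`, `ξ`, `γ`, `T` and of the gap `Δ = Δμ_T(i)`. -/
def constB (B ξ γ : ℝ) (T : ℕ) (Δ : ℝ) : ℝ :=
  16 * B ^ 2 * ξ / (γ ^ (1 / (1 - γ)) * Δ ^ 2) * (⌈(T : ℝ) * (1 - γ)⌉ / ((T : ℝ) * (1 - γ))) +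
    2 * ⌈-Real.log (1 - γ) / Real.log (1 + 4 * √(1 - 1 / (2 * ξ)))⌉ /
      (-Real.log (1 - γ) * (1 - γ ^ (1 / (1 - γ))))

/-- `C(γ)`, as a function of `ξ`, `γ` and of the number `K` of arms. -/
def constC (ξ γ : ℝ) (K : ℕ) : ℝ :=
  (γ - 1) / (Real.log (1 - γ) * Real.log γ) *
    Real.log ((1 - γ) * ξ * Real.log (discTotal γ K))

/-- Expected regret over `T` rounds against the strategy that plays `best t` in round `t`. -/
def regret (X : ℕ → Fin K → Ω → ℝ) (P : Measure Ω) (I : ℕ → Ω → Fin K) (best : ℕ → Fin K)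
    (T : ℕ) : ℝ :=
  ∫ ω, (∑ t ∈ Finset.Icc 1 T, X t (best t) ω - ∑ t ∈ Finset.Icc 1 T, X t (I t ω) ω) ∂P

end NonStatBandit

end

/-! A play of the non-optimal arm `i` in round `t + 1` has one of three causes. Let `L = log (1 / (1
- γ))` and `A = 16 B² ξ L / Δ²`. (a) The discounted count of `i` is at most `A`. A potential
argument (`sum_plays_of_discCount_le`) allows at most `(A + 1) (1 + T (1 - γ))` such plays. (b) A
breakpoint lies within the last `m = ⌊staleRounds⌋₊` rounds. This costs at most `m` rounds per
breakpoint. (c) A confidence bound fails, from above for `i` or from below for an optimal arm. If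
both hold, the choice of the policy forces `Δ ≤ 2 c_t(γ, i)`, which is case (a).

Outside (b), only weights of age at least `m` bias the discounted average, and `m` is chosen so that
their total `γ ^ m / (1 - γ)` is at most `6/5 ξ log n_t`. The factor `2` of the padding then splits
into `7/5` for the noise and `3/5` for the bias (`discMean_sub_mean_le`). The noise is controlled by
Hoeffding's exponential supermartingale. Since the discounted count is random, the event is peeled
along powers of `4`; its probability is at most `3 / (2 n_t)` (`measureReal_largeNoise_le`), and `1
/ n_t ≤ 1 / t + (1 - γ)` makes the sum over `t` small.

This works for `γ ≥ 5/6`. The rest of (1) is a comparison of constants: (b) gives exactly the `C(γ)`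
term, and the factor `γ ^ (-1 / (1 - γ)) ≥ e` in the first summand of `B(γ)` pays for (a) and (c);
the second summand only has to be nonnegative. For `L ≤ 7/2` the first summand alone already exceeds
`T`.

For (2), the tuning makes `T (1 - γ)` and `Υ / (1 - γ)` both multiples of `√(T Υ)`, and the regret
is at most `B` times the expected number of bad plays of all arms. -/

namespace NonStatBandit

/-! ### Filtration of past rewards and the exponential supermartingale. -/

variable {K : ℕ} {Ω : Type u} {B ξ γ : ℝ} {X : ℕ → Fin K → Ω → ℝ} {I : ℕ → Ω → Fin K}

/-- Every reward of a round up to `t` is measurable with respect to the past `past X t`. -/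
theorem measurable_past_reward {s t : ℕ} (hs : s ∈ Finset.Icc 1 t) (j : Fin K) :
    Measurable[past X t] (X s j) := by
  rw [measurable_iff_comap_le]
  exact le_iSup₂_of_le s hs (le_iSup (fun j => MeasurableSpace.comap (X s j) _) j)

theorem measurable_sum_ite [MeasurableSpace Ω] {t : ℕ} {i : Fin K} {f : ℕ → Ω → ℝ}
    (hf : ∀ s ∈ Finset.Icc 1 t, Measurable (f s)) (hI : ∀ s ∈ Finset.Icc 1 t, Measurable (I s)) :
    Measurable fun ω => ∑ s ∈ Finset.Icc 1 t, if I s ω = i then f s ω else 0 :=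
  Finset.measurable_fun_sum _ fun s hs =>
    Measurable.ite (hI s hs (measurableSet_singleton i)) (hf s hs) measurable_const

theorem past_mono {s t : ℕ} (h : s ≤ t) : past X s ≤ past X t := by
  refine iSup₂_le fun r hr => iSup_le fun j => ?_
  rw [← measurable_iff_comap_le]
  exact measurable_past_reward (by rw [Finset.mem_Icc] at *; omega) j

theorem IsDUCB.measurable_past (hI : IsDUCB B ξ γ X I) {s t : ℕ} (hs : s ∈ Finset.Icc 1 (t + 1)) :
    Measurable[past X t] (I s) := by
  rw [Finset.mem_Icc] at hs
  obtain ⟨r, rfl⟩ : ∃ r, s = r + 1 := ⟨s - 1, by omega⟩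
  exact (hI.nonanticipating r).mono (past_mono (by omega)) le_rfl

variable [MeasurableSpace Ω] {P : Measure Ω}

theorem IsEnvironment.past_le (hE : IsEnvironment B X P) (t : ℕ) : past X t ≤ ‹MeasurableSpace Ω› := by
  refine iSup₂_le fun r hr => iSup_le fun j => ?_
  rw [← measurable_iff_comap_le]
  exact hE.measurable r (Finset.mem_Icc.1 hr).1 j

theorem IsDUCB.measurable_arm (hI : IsDUCB B ξ γ X I) (hE : IsEnvironment B X P) {s : ℕ}
    (hs : 1 ≤ s) : Measurable (I s) :=
  (hI.measurable_past (t := s) (by simp [hs])).mono (hE.past_le s) le_rfl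

/-- The rewards of round `t + 1` are independent of the past. -/
theorem IsEnvironment.indep_past (hE : IsEnvironment B X P) (t : ℕ) (i : Fin K) :
    Indep (past X t) (MeasurableSpace.comap (X (t + 1) i) inferInstance) P := by
  have hle : ∀ n : ℕ, MeasurableSpace.comap (fun (ω : Ω) (j : Fin K) => X (n + 1) j ω) inferInstance
      ≤ ‹MeasurableSpace Ω› := fun n => by
    rw [← measurable_iff_comap_le]
    exact measurable_pi_lambda _ fun j => hE.measurable (n + 1) (by omega) j
  have hcoord : ∀ (n : ℕ) (j : Fin K), MeasurableSpace.comap (X (n + 1) j) inferInstance ≤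
      MeasurableSpace.comap (fun (ω : Ω) (j : Fin K) => X (n + 1) j ω) inferInstance := fun n j => by
    rw [← measurable_iff_comap_le]
    exact (measurable_pi_apply j).comp
      (comap_measurable fun (ω : Ω) (j : Fin K) => X (n + 1) j ω)
  -- Index `n` of the independent family is round `n + 1`, so the two index sets are rounds `1, …,
  -- t` and round `t + 1`.
  have h := indep_iSup_of_disjoint hle hE.indep (S := {n | n < t}) (T := {t}) (by simp)
  refine indep_of_indep_of_le h ?_ ?_
  · refine iSup₂_le fun r hr => iSup_le fun j => ?_
    rw [Finset.mem_Icc] at hr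
    obtain ⟨n, rfl⟩ : ∃ n, r = n + 1 := ⟨r - 1, by omega⟩
    exact (hcoord n j).trans (le_iSup₂_of_le n (by simp; omega) le_rfl)
  · exact (hcoord t i).trans (le_iSup₂_of_le t rfl le_rfl)

/-- Exponent of the supermartingale that controls the weighted rewards of arm `i`. -/
noncomputable def compensatedSum (B : ℝ) (X : ℕ → Fin K → Ω → ℝ) (P : Measure Ω)
    (I : ℕ → Ω → Fin K) (a : ℕ → ℝ) (t : ℕ) (i : Fin K) (ω : Ω) : ℝ :=
  ∑ s ∈ Finset.Icc 1 t,
    if I s ω = i then a s * (X s i ω - mean X P s i) - a s ^ 2 * B ^ 2 / 8 else 0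

theorem measurable_past_compensatedSum (hI : IsDUCB B ξ γ X I) (a : ℕ → ℝ) (t : ℕ) (i : Fin K) :
    Measurable[past X t] (compensatedSum B X P I a t i) := by
  refine @measurable_sum_ite _ _ _ (past X t) t i
    (fun s ω => a s * (X s i ω - mean X P s i) - a s ^ 2 * B ^ 2 / 8) (fun s hs => ?_)
    (fun s hs => ?_)
  · have := measurable_past_reward (X := X) hs i
    generalize past X t = m at this
    fun_prop
  · exact hI.measurable_past (by rw [Finset.mem_Icc] at *; omega)

/-- Hoeffding's lemma: a variable with values in an interval of length `B` is sub-Gaussian with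
variance proxy `(B / 2) ^ 2`. -/
theorem IsEnvironment.lintegral_exp_le [IsProbabilityMeasure P] (hE : IsEnvironment B X P)
    {t : ℕ} (ht : 1 ≤ t) (i : Fin K) (a : ℝ) :
    ∫⁻ ω, ENNReal.ofReal (Real.exp (a * (X t i ω - mean X P t i) - a ^ 2 * B ^ 2 / 8)) ∂P ≤ 1 := by
  have h := hasSubgaussianMGF_of_mem_Icc (hE.measurable t ht i).aemeasurable (hE.bounded t ht i)
  have hexp : ∀ ω, Real.exp (a * (X t i ω - mean X P t i) - a ^ 2 * B ^ 2 / 8) =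
      Real.exp (a * (X t i ω - mean X P t i)) * Real.exp (-(a ^ 2 * B ^ 2 / 8)) := fun ω => by
    rw [← Real.exp_add, sub_eq_add_neg]
  have hint : Integrable (fun ω => Real.exp (a * (X t i ω - mean X P t i))) P :=
    h.integrable_exp_mul a
  have hm : ∫ ω, Real.exp (a * (X t i ω - mean X P t i)) ∂P ≤ Real.exp (a ^ 2 * B ^ 2 / 8) := by
    refine (h.mgf_le a).trans (Real.exp_le_exp.2 (le_of_eq ?_))
    simp only [sub_zero, NNReal.coe_pow, NNReal.coe_div, coe_nnnorm, NNReal.coe_ofNat,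
      Real.norm_eq_abs, div_pow, sq_abs]
    ring
  rw [← ofReal_integral_eq_lintegral_ofReal]
  · rw [← ENNReal.ofReal_one]
    refine ENNReal.ofReal_le_ofReal ?_
    simp_rw [hexp]
    rw [integral_mul_const, Real.exp_neg, ← div_eq_mul_inv, div_le_one (Real.exp_pos _)]
    exact hm
  · simp_rw [hexp]
    exact hint.mul_const _
  · exact Filter.Eventually.of_forall fun ω => (Real.exp_pos _).le

/-- Supermartingale property, by induction on the rounds. The weights `a` must be deterministic, but
may depend on the final time; this admits `γ ^ (t - s)`. -/
theorem lintegral_exp_compensatedSum_le [IsProbabilityMeasure P] (hE : IsEnvironment B X P)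
    (hI : IsDUCB B ξ γ X I) (a : ℕ → ℝ) (t : ℕ) (i : Fin K) :
    ∫⁻ ω, ENNReal.ofReal (Real.exp (compensatedSum B X P I a t i ω)) ∂P ≤ 1 := by
  induction t with
  | zero => simp [compensatedSum]
  | succ t ih =>
    set W : Ω → ENNReal := fun ω => ENNReal.ofReal (Real.exp (compensatedSum B X P I a t i ω))
      with hWdef
    set G : Ω → ENNReal := fun ω => ENNReal.ofReal
      (Real.exp (a (t + 1) * (X (t + 1) i ω - mean X P (t + 1) i) - a (t + 1) ^ 2 * B ^ 2 / 8))
    set S : Set Ω := {ω | I (t + 1) ω = i} with hSdef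
    have hS : MeasurableSet[past X t] S :=
      hI.nonanticipating t (measurableSet_singleton i)
    have hW : Measurable[past X t] W :=
      ENNReal.measurable_ofReal.comp
        (Real.measurable_exp.comp (measurable_past_compensatedSum hI a t i))
    have hG : Measurable[MeasurableSpace.comap (X (t + 1) i) inferInstance] G := by
      have : Measurable[MeasurableSpace.comap (X (t + 1) i) inferInstance] (X (t + 1) i) :=
        comap_measurable _
      generalize MeasurableSpace.comap (X (t + 1) i) inferInstance = m at this
      fun_prop
    have hS' := hE.past_le t _ hS
    have hW' := hW.mono (hE.past_le t) le_rfl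
    have hle : MeasurableSpace.comap (X (t + 1) i) inferInstance ≤ ‹MeasurableSpace Ω› :=
      measurable_iff_comap_le.1 (hE.measurable (t + 1) (by omega) i)
    -- The new factor `G` enters only on the event that arm `i` is played. That event and `W` depend
    -- on the past, `G` on the new reward, so the expectation of the product factorizes.
    have hsplit : ∀ ω, ENNReal.ofReal (Real.exp (compensatedSum B X P I a (t + 1) i ω)) =
        Sᶜ.indicator W ω + S.indicator W ω * G ω := fun ω => by
      have hsum : compensatedSum B X P I a (t + 1) i ω = compensatedSum B X P I a t i ω +
          if I (t + 1) ω = i then a (t + 1) * (X (t + 1) i ω - mean X P (t + 1) i)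
            - a (t + 1) ^ 2 * B ^ 2 / 8 else 0 := by
        unfold compensatedSum
        rw [Finset.sum_Icc_succ_top (by omega)]
      rw [hsum]
      by_cases h : I (t + 1) ω = i
      · have hmem : ω ∈ S := h
        simp [h, hmem, W, G, Real.exp_add, ENNReal.ofReal_mul (Real.exp_pos _).le]
      · have hmem : ω ∉ S := h
        simp [h, hmem, W]
    simp_rw [hsplit]
    rw [lintegral_add_left (hW'.indicator hS'.compl),
      lintegral_mul_eq_lintegral_mul_lintegral_of_independent_measurableSpace (hE.past_le t) hle
        (hE.indep_past t i) (hW.indicator hS) hG]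
    calc _ ≤ (∫⁻ ω, Sᶜ.indicator W ω ∂P) + (∫⁻ ω, S.indicator W ω ∂P) * 1 := by
          gcongr
          exact hE.lintegral_exp_le (by omega) i (a (t + 1))
      _ = ∫⁻ ω, W ω ∂P := by
          rw [mul_one, ← lintegral_add_left (hW'.indicator hS'.compl)]
          refine lintegral_congr fun ω => ?_
          by_cases h : ω ∈ S <;> simp [h]
      _ ≤ 1 := ih

theorem measure_compensatedSum_ge_le [IsProbabilityMeasure P] (hE : IsEnvironment B X P)
    (hI : IsDUCB B ξ γ X I) (a : ℕ → ℝ) (t : ℕ) (i : Fin K) (y : ℝ) :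
    P {ω | y ≤ compensatedSum B X P I a t i ω} ≤ ENNReal.ofReal (Real.exp (-y)) := by
  have hm := (measurable_past_compensatedSum (P := P) hI a t i).mono (hE.past_le t) le_rfl
  have h := meas_ge_le_lintegral_div (μ := P)
    (f := fun ω => ENNReal.ofReal (Real.exp (compensatedSum B X P I a t i ω)))
    (by fun_prop) (ε := ENNReal.ofReal (Real.exp y)) (by simp [Real.exp_pos]) (by simp)
  refine (measure_mono ?_).trans (h.trans ?_)
  · intro ω hω
    exact ENNReal.ofReal_le_ofReal (Real.exp_le_exp.2 hω)
  · rw [Real.exp_neg, ENNReal.ofReal_inv_of_pos (Real.exp_pos y), ← one_div]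
    gcongr
    exact lintegral_exp_compensatedSum_le hE hI a t i

end NonStatBandit

/-! ### Discounted counts and the peeled deviation inequality. -/

namespace NonStatBandit

section Discount

variable {γ : ℝ}

theorem discTotal_eq (hγ1 : γ < 1) (t : ℕ) : discTotal γ t = (1 - γ ^ t) / (1 - γ) := by
  induction t with
  | zero => simp [discTotal]
  | succ t ih =>
    have hsum : discTotal γ (t + 1) = γ * discTotal γ t + 1 := by
      unfold discTotal
      rw [Finset.sum_Icc_succ_top (by omega), Nat.sub_self, pow_zero, Finset.mul_sum]
      congr 1
      refine Finset.sum_congr rfl fun s hs => ?_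
      rw [Finset.mem_Icc] at hs
      rw [Nat.sub_add_comm hs.2, pow_succ']
    have : 1 - γ ≠ 0 := by linarith
    rw [hsum, ih]
    field_simp
    ring

theorem discTotal_mono (hγ0 : 0 < γ) (hγ1 : γ < 1) {s t : ℕ} (h : s ≤ t) :
    discTotal γ s ≤ discTotal γ t := by
  rw [discTotal_eq hγ1, discTotal_eq hγ1]
  have := pow_le_pow_of_le_one hγ0.le hγ1.le h
  have : 0 < 1 - γ := by linarith
  gcongr

theorem discTotal_le (hγ0 : 0 < γ) (hγ1 : γ < 1) (t : ℕ) : discTotal γ t ≤ 1 / (1 - γ) := by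
  rw [discTotal_eq hγ1]
  have := pow_pos hγ0 t
  have : 0 < 1 - γ := by linarith
  gcongr
  linarith

theorem one_le_discTotal (hγ0 : 0 < γ) (hγ1 : γ < 1) {t : ℕ} (ht : 1 ≤ t) : 1 ≤ discTotal γ t := by
  refine le_trans (le_of_eq ?_) (discTotal_mono hγ0 hγ1 ht)
  simp [discTotal]

theorem one_add_le_discTotal (hγ0 : 0 < γ) (hγ1 : γ < 1) {t : ℕ} (ht : 2 ≤ t) :
    1 + γ ≤ discTotal γ t := by
  refine le_trans (le_of_eq ?_) (discTotal_mono hγ0 hγ1 ht)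
  rw [discTotal, Finset.sum_Icc_succ_top (by norm_num)]
  norm_num
  ring

/-- Bernoulli's inequality and `γ (2 - γ) ≤ 1` give `γ ^ t (1 + t (1 - γ)) ≤ 1`, hence `n_t ≥ t / (1
+ t (1 - γ))`. -/
theorem inv_discTotal_le (hγ0 : 0 < γ) (hγ1 : γ < 1) {t : ℕ} (ht : 1 ≤ t) :
    1 / discTotal γ t ≤ 1 / t + (1 - γ) := by
  have htpos : (0 : ℝ) < t := by exact_mod_cast ht
  have he : 0 < 1 - γ := by linarith
  have h1 : 1 + t * (1 - γ) ≤ (1 + (1 - γ)) ^ t := one_add_mul_le_pow (by linarith) t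
  have h2 : γ ^ t * (1 + (1 - γ)) ^ t ≤ 1 := by
    rw [← mul_pow]
    exact pow_le_one₀ (by nlinarith) (by nlinarith)
  have h3 : γ ^ t * (1 + t * (1 - γ)) ≤ 1 :=
    (mul_le_mul_of_nonneg_left h1 (pow_pos hγ0 t).le).trans h2
  have h4 : t / (1 + t * (1 - γ)) ≤ discTotal γ t := by
    rw [discTotal_eq hγ1, div_le_div_iff₀ (by positivity) he]
    linarith
  calc 1 / discTotal γ t ≤ 1 / (t / (1 + t * (1 - γ))) := by gcongr
    _ = 1 / t + (1 - γ) := by field_simp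

variable {K : ℕ} {Ω : Type u} {I : ℕ → Ω → Fin K}

theorem discCount_le_discTotal (hγ0 : 0 < γ) (t : ℕ) (i : Fin K) (ω : Ω) :
    discCount γ I t i ω ≤ discTotal γ t := by
  refine Finset.sum_le_sum fun s _ => ?_
  have := pow_pos hγ0 (t - s)
  split_ifs <;> simp [this.le]

theorem discCount_succ (t : ℕ) (i : Fin K) (ω : Ω) :
    discCount γ I (t + 1) i ω = γ * discCount γ I t i ω + if I (t + 1) ω = i then 1 else 0 := by
  unfold discCount
  rw [Finset.sum_Icc_succ_top (by omega), Nat.sub_self, pow_zero, one_mul, Finset.mul_sum]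
  congr 1
  refine Finset.sum_congr rfl fun s hs => ?_
  rw [Finset.mem_Icc] at hs
  rw [Nat.sub_add_comm hs.2, pow_succ', mul_assoc]

end Discount

variable {K : ℕ} {Ω : Type u} [MeasurableSpace Ω] {B ξ γ : ℝ} {X : ℕ → Fin K → Ω → ℝ}
  {I : ℕ → Ω → Fin K} {P : Measure Ω}

/-- Discounted sum of the centred rewards of arm `i`. -/
noncomputable def discNoise (γ : ℝ) (X : ℕ → Fin K → Ω → ℝ) (P : Measure Ω) (I : ℕ → Ω → Fin K)
    (t : ℕ) (i : Fin K) (ω : Ω) : ℝ :=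
  ∑ s ∈ Finset.Icc 1 t, if I s ω = i then γ ^ (t - s) * (X s i ω - mean X P s i) else 0

/-- The event that the discounted noise of arm `i`, multiplied by the sign `σ`, is large compared
with the discounted number of plays. -/
def largeNoise (B ξ γ : ℝ) (X : ℕ → Fin K → Ω → ℝ) (P : Measure Ω) (I : ℕ → Ω → Fin K)
    (σ : ℝ) (t : ℕ) (i : Fin K) : Set Ω :=
  {ω | 1 ≤ discCount γ I t i ω ∧
    7 / 5 * B * √(ξ * Real.log (discTotal γ t) * discCount γ I t i ω) <
      σ * discNoise γ X P I t i ω}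

theorem measurableSet_largeNoise (hE : IsEnvironment B X P) (hI : IsDUCB B ξ γ X I) (σ : ℝ)
    (t : ℕ) (i : Fin K) : MeasurableSet (largeNoise B ξ γ X P I σ t i) := by
  have hI' : ∀ s ∈ Finset.Icc 1 t, Measurable (I s) := fun s hs =>
    hI.measurable_arm hE (Finset.mem_Icc.1 hs).1
  have hN : Measurable (discCount γ I t i) := by
    have := measurable_sum_ite (i := i) (f := fun s _ => γ ^ (t - s))
      (fun s _ => measurable_const) hI'
    unfold discCount
    simpa only [mul_ite, mul_one, mul_zero] using this
  have hD : Measurable (discNoise γ X P I t i) :=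
    measurable_sum_ite (fun s hs => by
      have := hE.measurable s (Finset.mem_Icc.1 hs).1 i
      fun_prop) hI'
  refine (measurableSet_le measurable_const hN).inter
    (measurableSet_lt (f := fun ω => 7 / 5 * B * √(ξ * Real.log (discTotal γ t) *
      discCount γ I t i ω)) (g := fun ω => σ * discNoise γ X P I t i ω) ?_ ?_)
  · fun_prop
  · fun_prop

/-- The compensator carries squared weights; since they are at most `1`, `γ ^ (2 (t - s)) ≤ γ ^ (t -
s)`, and the ordinary discounted count suffices. -/
theorem le_compensatedSum (hγ0 : 0 < γ) (hγ1 : γ < 1) (a σ : ℝ) (hσ : σ ^ 2 = 1) (t : ℕ) (i : Fin K)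
    (ω : Ω) :
    a * (σ * discNoise γ X P I t i ω) - a ^ 2 * B ^ 2 / 8 * discCount γ I t i ω ≤
      compensatedSum B X P I (fun s => a * σ * γ ^ (t - s)) t i ω := by
  unfold discNoise discCount compensatedSum
  rw [Finset.mul_sum, Finset.mul_sum, Finset.mul_sum, ← Finset.sum_sub_distrib]
  refine Finset.sum_le_sum fun s _ => ?_
  split_ifs
  · have h1 : (γ ^ (t - s)) ^ 2 ≤ γ ^ (t - s) := by
      have h0 := pow_pos hγ0 (t - s)
      have := pow_le_one₀ hγ0.le hγ1.le (n := t - s)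
      nlinarith
    have h2 : (a * σ * γ ^ (t - s)) ^ 2 = a ^ 2 * (γ ^ (t - s)) ^ 2 := by
      rw [mul_pow, mul_pow, hσ, mul_one]
    have h3 : a ^ 2 * B ^ 2 / 8 * (γ ^ (t - s)) ^ 2 ≤ a ^ 2 * B ^ 2 / 8 * γ ^ (t - s) := by
      gcongr
    rw [h2]
    linarith
  · simp

theorem one_add_mul_exp_le (y : ℝ) :
    (1 + 3 / 4 * y) * Real.exp (-(3 / 2 * y)) ≤ 3 / 2 * Real.exp (-y) := by
  have h1 : Real.exp (-(3 / 2 * y)) = Real.exp (-y) * Real.exp (-(y / 2)) := by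
    rw [← Real.exp_add]; ring_nf
  have h2 : (1 + y / 2) * Real.exp (-(y / 2)) ≤ 1 := by
    rw [Real.exp_neg, ← div_eq_mul_inv, div_le_one (Real.exp_pos _)]
    linarith [Real.add_one_le_exp (y / 2)]
  have h3 := Real.exp_pos (-y)
  have h4 := Real.exp_pos (-(y / 2))
  have h5 : (1 + 3 / 4 * y) * Real.exp (-(y / 2)) ≤ 3 / 2 := by nlinarith
  rw [h1]
  nlinarith

/-- Peeling: on each slice `4 ^ k ≤ N < 4 ^ (k + 1)` of the random count `N`, one deterministic
exponent is nearly optimal. There are at most `1 + 3/4 log n` slices of probability at most `n ^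
(-3/2)`, and the surplus `n ^ (-1/2)` absorbs their number. -/
theorem measureReal_largeNoise_le [IsProbabilityMeasure P] (hB : 0 < B) (hξ : 1 / 2 < ξ)
    (hγ0 : 0 < γ) (hγ1 : γ < 1) (hE : IsEnvironment B X P) (hI : IsDUCB B ξ γ X I) {σ : ℝ}
    (hσ : σ ^ 2 = 1) {t : ℕ} (ht : 1 ≤ t) (i : Fin K) :
    P.real (largeNoise B ξ γ X P I σ t i) ≤ 3 / 2 / discTotal γ t := by
  have hn := one_le_discTotal hγ0 hγ1 ht
  set n := discTotal γ t
  set l := Real.log n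
  have hl : 0 ≤ l := Real.log_nonneg hn
  set q := √(ξ * l)
  have hq : q ^ 2 = ξ * l := Real.sq_sqrt (by positivity)
  -- For a given `N` the optimal exponent is `28 q / (5 B √N)`; this is its value at `√N = 7/5 * 2 ^
  -- k`, near the middle of the slice.
  let a : ℕ → ℝ := fun k => 4 * q / (2 ^ k * B)
  let m : ℕ := ⌊3 / 4 * l⌋₊
  have hsub : largeNoise B ξ γ X P I σ t i ⊆ ⋃ k ∈ Finset.range (m + 1),
      {ω | 3 / 2 * l ≤ compensatedSum B X P I (fun s => a k * σ * γ ^ (t - s)) t i ω} := by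
    rintro ω ⟨h1, h2⟩
    set N := discCount γ I t i ω
    obtain ⟨k, hk1, hk2⟩ := exists_nat_pow_near h1 (by norm_num : (1 : ℝ) < 4)
    simp only [Set.mem_iUnion, Finset.mem_range, Set.mem_ofPred_eq]
    refine ⟨k, ?_, le_trans ?_ (le_compensatedSum hγ0 hγ1 (a k) σ hσ t i ω)⟩
    · rw [Nat.lt_add_one_iff]
      refine Nat.le_floor ?_
      have h4 : (4 : ℝ) ^ k ≤ n := hk1.trans (discCount_le_discTotal hγ0 t i ω)
      have h5 : k * Real.log 4 ≤ l := by
        rw [← Real.log_pow]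
        exact Real.log_le_log (by positivity) h4
      have h6 : 4 / 3 ≤ Real.log 4 := by
        rw [show (4 : ℝ) = 2 ^ 2 by norm_num, Real.log_pow]
        have := Real.log_two_gt_d9
        push_cast
        linarith
      have : (0 : ℝ) ≤ k := by positivity
      nlinarith
    · have hp : √N ^ 2 = N := Real.sq_sqrt (by linarith)
      have hp0 := Real.sqrt_nonneg N
      have hg : (0 : ℝ) < 2 ^ k := by positivity
      have h4k : (4 : ℝ) ^ k = (2 ^ k) ^ 2 := by rw [← pow_mul, mul_comm, pow_mul]; norm_num
      set z := √N / 2 ^ k with hz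
      have hzN : √N = z * 2 ^ k := by rw [hz]; field_simp
      have hz1 : 1 ≤ z := by
        rw [hz, le_div_iff₀ hg, one_mul]
        exact Real.le_sqrt_of_sq_le (by rw [← h4k]; exact hk1)
      have hz2 : z ≤ 2 := by
        rw [hz, div_le_iff₀ hg]
        refine Real.sqrt_le_iff.2 ⟨by positivity, ?_⟩
        rw [mul_pow, ← h4k]
        rw [pow_succ] at hk2
        linarith
      have hsq : √(ξ * l * N) = q * √N := Real.sqrt_mul (by positivity) N
      have ha : 0 ≤ a k := by positivity
      have h3 : a k * (7 / 5 * B * (q * √N)) ≤ a k * (σ * discNoise γ X P I t i ω) := by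
        rw [← hsq]
        exact mul_le_mul_of_nonneg_left h2.le ha
      have e1 : a k * (7 / 5 * B * (q * √N)) = 28 / 5 * q ^ 2 * z := by
        simp only [a]; rw [hzN]; field_simp; ring
      have e2 : a k ^ 2 * B ^ 2 / 8 * N = 2 * q ^ 2 * z ^ 2 := by
        simp only [a]; rw [← hp, hzN]; field_simp; ring
      rw [e1] at h3
      rw [e2]
      -- `28/5 z - 2 z² = 2 (z - 1) (2 - z) + 2/5 (2 - z) + 16/5`, which is at least `3` on `[1,
      -- 2]`; then `ξ > 1/2` gives `3 q² ≥ 3/2 l`.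
      have h7 : 0 ≤ q ^ 2 * ((z - 1) * (2 - z)) := by
        have := mul_nonneg (sub_nonneg.2 hz1) (sub_nonneg.2 hz2)
        positivity
      have h8 : 0 ≤ q ^ 2 * (2 - z) := mul_nonneg (sq_nonneg _) (by linarith)
      have h9 : 3 / 2 * l ≤ 3 * q ^ 2 := by rw [hq]; nlinarith
      nlinarith
  have hmeas : P (largeNoise B ξ γ X P I σ t i) ≤
      ENNReal.ofReal ((m + 1) * Real.exp (-(3 / 2 * l))) := by
    refine (measure_mono hsub).trans ((measure_biUnion_finset_le _ _).trans ?_)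
    refine (Finset.sum_le_sum fun k _ => measure_compensatedSum_ge_le hE hI _ t i _).trans ?_
    rw [Finset.sum_const, Finset.card_range, nsmul_eq_mul, ENNReal.ofReal_mul (by positivity)]
    gcongr
    rw [← Nat.cast_succ, ENNReal.ofReal_natCast]
  have hreal : P.real (largeNoise B ξ γ X P I σ t i) ≤ (m + 1) * Real.exp (-(3 / 2 * l)) :=
    ENNReal.toReal_le_of_le_ofReal (by positivity) hmeas
  have hm : (m : ℝ) ≤ 3 / 4 * l := Nat.floor_le (by positivity)
  have hexp : Real.exp (-l) = 1 / n := by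
    rw [Real.exp_neg, Real.exp_log (by linarith), one_div]
  calc _ ≤ (m + 1) * Real.exp (-(3 / 2 * l)) := hreal
    _ ≤ (1 + 3 / 4 * l) * Real.exp (-(3 / 2 * l)) := by
        exact mul_le_mul_of_nonneg_right (by linarith) (Real.exp_pos _).le
    _ ≤ 3 / 2 * Real.exp (-l) := one_add_mul_exp_le l
    _ = 3 / 2 / n := by rw [hexp]; ring

end NonStatBandit

/-! ### Deterministic counting estimates. -/

namespace NonStatBandit

section Counting

variable {K : ℕ} {Ω : Type u} {I : ℕ → Ω → Fin K} {B γ : ℝ}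
  {X : ℕ → Fin K → Ω → ℝ}

theorem sum_Icc_one_eq_sum_range (f : ℕ → ℝ) (T : ℕ) :
    ∑ t ∈ Finset.Icc 1 T, f t = ∑ t ∈ Finset.range T, f (t + 1) := by
  induction T with
  | zero => simp
  | succ T ih => rw [Finset.sum_Icc_succ_top (by omega), Finset.sum_range_succ, ih]

open Classical in
/-- An arm is rarely played while its discounted number of plays is small. -/
theorem sum_plays_of_discCount_le (hγ0 : 0 < γ) (hγ1 : γ < 1) {A : ℝ} (hA : 0 ≤ A) (i : Fin K)
    (ω : Ω) (T : ℕ) :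
    ∑ t ∈ Finset.range T, (if I (t + 1) ω = i ∧ discCount γ I t i ω ≤ A then (1 : ℝ) else 0) ≤
      (A + 1) * (1 + T * (1 - γ)) := by
  -- The potential `M` is the discounted number of the counted plays only. A counted play adds `1`
  -- when `M ≤ A`, so `M ≤ A + 1` always, and discounting removes at most `(A + 1) (1 - γ)` per
  -- round.
  suffices h : ∃ M : ℝ, 0 ≤ M ∧ M ≤ discCount γ I T i ω ∧ M ≤ A + 1 ∧
      ∑ t ∈ Finset.range T, (if I (t + 1) ω = i ∧ discCount γ I t i ω ≤ A then (1 : ℝ) else 0) ≤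
        M + (A + 1) * (T * (1 - γ)) by
    obtain ⟨M, -, -, h1, h2⟩ := h
    linarith
  induction T with
  | zero => exact ⟨0, le_rfl, by simp [discCount], by linarith, by simp⟩
  | succ T ih =>
    obtain ⟨M, h0, h1, h2, h3⟩ := ih
    have h4 : (1 - γ) * M ≤ (A + 1) * (1 - γ) := by nlinarith
    have h5 : γ * M ≤ M := by nlinarith
    have h6 : γ * M ≤ γ * discCount γ I T i ω := mul_le_mul_of_nonneg_left h1 hγ0.le
    have h7 : 0 ≤ γ * M := by positivity
    rw [Finset.sum_range_succ, discCount_succ]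
    by_cases h : I (T + 1) ω = i ∧ discCount γ I T i ω ≤ A
    · refine ⟨γ * M + 1, by linarith, ?_, by linarith [h.2], ?_⟩
      · rw [if_pos h.1]; linarith
      · rw [if_pos h]; push_cast; linarith
    · refine ⟨γ * M, h7, ?_, by linarith, ?_⟩
      · split_ifs <;> linarith
      · rw [if_neg h]; push_cast; linarith

theorem sum_discounts_of_add_le (hγ0 : 0 < γ) (hγ1 : γ < 1) (t m : ℕ) :
    ∑ s ∈ Finset.Icc 1 t, (if s + m ≤ t then γ ^ (t - s) else 0) ≤ γ ^ m / (1 - γ) := by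
  have hm := pow_pos hγ0 m
  have he : 0 < 1 - γ := by linarith
  rw [← Finset.sum_filter]
  rcases le_or_gt m t with h | h
  · have hset : (Finset.Icc 1 t).filter (fun s => s + m ≤ t) = Finset.Icc 1 (t - m) := by
      ext s
      simp only [Finset.mem_filter, Finset.mem_Icc]
      omega
    have hsum : ∑ s ∈ Finset.Icc 1 (t - m), γ ^ (t - s) = γ ^ m * discTotal γ (t - m) := by
      rw [discTotal, Finset.mul_sum]
      refine Finset.sum_congr rfl fun s hs => ?_
      rw [Finset.mem_Icc] at hs
      rw [← pow_add]
      congr 1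
      omega
    rw [hset, hsum, div_eq_mul_one_div]
    exact mul_le_mul_of_nonneg_left (discTotal_le hγ0 hγ1 _) hm.le
  · rw [Finset.sum_eq_zero]
    · positivity
    · intro s hs
      rw [Finset.mem_filter] at hs
      omega

theorem discMean_mem_Icc (hγ0 : 0 < γ) {t : ℕ} {i : Fin K} {ω : Ω}
    (hb : ∀ s, 1 ≤ s → X s i ω ∈ Set.Icc 0 B) (hN : 0 < discCount γ I t i ω) :
    discMean γ X I t i ω ∈ Set.Icc 0 B := by
  have hs : ∀ s ∈ Finset.Icc 1 t, 0 ≤ γ ^ (t - s) * X s i ω * (if I s ω = i then 1 else 0) ∧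
      γ ^ (t - s) * X s i ω * (if I s ω = i then 1 else 0) ≤
        B * (γ ^ (t - s) * (if I s ω = i then 1 else 0)) := fun s hs => by
    obtain ⟨h0, h1⟩ := hb s (Finset.mem_Icc.1 hs).1
    have := pow_pos hγ0 (t - s)
    split_ifs
    · constructor
      · positivity
      · nlinarith
    · simp
  constructor
  · exact div_nonneg (Finset.sum_nonneg fun s h => (hs s h).1) hN.le
  · rw [discMean, div_le_iff₀ hN, discCount, Finset.mul_sum]
    exact Finset.sum_le_sum fun s h => (hs s h).2

end Counting

variable {K : ℕ} {Ω : Type u} [MeasurableSpace Ω] {B ξ γ : ℝ} {X : ℕ → Fin K → Ω → ℝ}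
  {I : ℕ → Ω → Fin K} {P : Measure Ω}

/-! ### Gaps, breakpoints and stale rounds. -/

section Environment

theorem IsEnvironment.mean_mem_Icc [IsProbabilityMeasure P] (hE : IsEnvironment B X P) {t : ℕ}
    (ht : 1 ≤ t) (i : Fin K) : mean X P t i ∈ Set.Icc 0 B := by
  have hint := Integrable.of_mem_Icc 0 B (hE.measurable t ht i).aemeasurable (hE.bounded t ht i)
  constructor
  · exact integral_nonneg_of_ae ((hE.bounded t ht i).mono fun ω h => h.1)
  · have := integral_mono_ae hint (integrable_const B) ((hE.bounded t ht i).mono fun ω h => h.2)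
    simpa [mean] using this

theorem mean_le_bestMean (t : ℕ) (i : Fin K) : mean X P t i ≤ bestMean X P t :=
  le_ciSup (f := fun j => mean X P t j) (Set.finite_range _).bddAbove i

theorem exists_mean_eq_bestMean (hK : 0 < K) (t : ℕ) : ∃ j, mean X P t j = bestMean X P t := by
  have : Nonempty (Fin K) := ⟨⟨0, hK⟩⟩
  exact exists_eq_ciSup_of_finite

theorem finite_gaps (X : ℕ → Fin K → Ω → ℝ) (P : Measure Ω) (T : ℕ) (i : Fin K) :
    {d | ∃ t ∈ Finset.Icc 1 T, mean X P t i < bestMean X P t ∧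
      d = bestMean X P t - mean X P t i}.Finite := by
  refine ((Finset.Icc 1 T).finite_toSet.image fun t => bestMean X P t - mean X P t i).subset ?_
  rintro d ⟨t, ht, -, rfl⟩
  exact ⟨t, ht, rfl⟩

theorem minGap_le {T t : ℕ} (ht : t ∈ Finset.Icc 1 T) {i : Fin K}
    (h : mean X P t i < bestMean X P t) : minGap X P T i ≤ bestMean X P t - mean X P t i :=
  csInf_le (finite_gaps X P T i).bddBelow ⟨t, ht, h, rfl⟩

theorem exists_minGap_eq {T t : ℕ} (ht : t ∈ Finset.Icc 1 T) {i : Fin K}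
    (h : mean X P t i < bestMean X P t) :
    ∃ s ∈ Finset.Icc 1 T, mean X P s i < bestMean X P s ∧
      minGap X P T i = bestMean X P s - mean X P s i := by
  have hne : {d | ∃ t ∈ Finset.Icc 1 T, mean X P t i < bestMean X P t ∧
      d = bestMean X P t - mean X P t i}.Nonempty := ⟨_, t, ht, h, rfl⟩
  exact hne.csInf_mem (finite_gaps X P T i)

theorem badPlays_eq_zero {T : ℕ} {i : Fin K}
    (h : ¬ ∃ t ∈ Finset.Icc 1 T, mean X P t i < bestMean X P t) (ω : Ω) :
    badPlays X P I T i ω = 0 :=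
  Finset.sum_eq_zero fun t ht => if_neg fun h' => h ⟨t, ht, h'.2⟩

theorem badPlays_nonneg (T : ℕ) (i : Fin K) (ω : Ω) : 0 ≤ badPlays X P I T i ω :=
  Finset.sum_nonneg fun t _ => by split_ifs <;> norm_num

theorem badPlays_le (T : ℕ) (i : Fin K) (ω : Ω) : badPlays X P I T i ω ≤ T := by
  calc badPlays X P I T i ω ≤ ∑ t ∈ Finset.Icc 1 T, (1 : ℝ) :=
        Finset.sum_le_sum fun t _ => by split_ifs <;> norm_num
    _ = T := by simp

open Classical in
/-- The breakpoints among the first `T` rounds. -/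
noncomputable def breakpoints (X : ℕ → Fin K → Ω → ℝ) (P : Measure Ω) (T : ℕ) : Finset ℕ :=
  (Finset.Ico 1 T).filter (fun t => ∃ i, P.map (X (t + 1) i) ≠ P.map (X t i))

theorem card_breakpoints (T : ℕ) : (breakpoints X P T).card = numBreakpoints X P T := rfl

/-- A breakpoint occurred less than `m` rounds before the end of round `t`. -/
def IsStale (X : ℕ → Fin K → Ω → ℝ) (P : Measure Ω) (T m t : ℕ) : Prop :=
  ∃ b ∈ breakpoints X P T, b ≤ t ∧ t < b + m

open Classical in
theorem sum_isStale_le (T m : ℕ) :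
    ∑ t ∈ Finset.range T, (if IsStale X P T m t then (1 : ℝ) else 0) ≤ m * numBreakpoints X P T := by
  rw [← Finset.sum_filter, Finset.sum_const, nsmul_eq_mul, mul_one, ← card_breakpoints, mul_comm]
  have hsub : (Finset.range T).filter (IsStale X P T m) ⊆
      (breakpoints X P T).biUnion fun b => Finset.Ico b (b + m) := by
    intro t ht
    obtain ⟨b, hb, h⟩ := (Finset.mem_filter.1 ht).2
    exact Finset.mem_biUnion.2 ⟨b, hb, Finset.mem_Ico.2 h⟩
  have := (Finset.card_le_card hsub).trans
    (Finset.card_biUnion_le_card_mul _ _ m fun b _ => by simp)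
  exact_mod_cast this

theorem IsEnvironment.mean_eq_of_not_isStale (hE : IsEnvironment B X P) {T m t : ℕ} (htT : t < T)
    (hs : ¬ IsStale X P T m t) (i : Fin K) {s : ℕ} (h1 : 1 ≤ s) (hst : s ≤ t + 1)
    (hm : t < s + m) : mean X P s i = mean X P (t + 1) i := by
  induction hst using Nat.decreasingInduction with
  | self => rfl
  | of_succ s hst ih =>
    rw [← ih (by omega) (by omega)]
    have hmap : P.map (X (s + 1) i) = P.map (X s i) := by
      by_contra hne
      -- A change between rounds `s` and `s + 1` is the breakpoint `s`. The last one excluded is `s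
      -- = t`, so the means also agree with round `t + 1`, in which the arm is chosen.
      refine hs ⟨s, ?_, by omega, hm⟩
      simp only [breakpoints, Finset.mem_filter, Finset.mem_Ico]
      exact ⟨⟨h1, by omega⟩, i, hne⟩
    have hmean : ∀ r, 1 ≤ r → mean X P r i = ∫ x, x ∂(P.map (X r i)) := fun r hr =>
      (integral_map (f := id) (hE.measurable r hr i).aemeasurable
        measurable_id.aestronglyMeasurable).symm
    rw [hmean s h1, hmean (s + 1) (by omega), hmap]

end Environment

/-! ### Bias of the discounted average and validity of the confidence bound. -/

section Confidence

theorem IsEnvironment.abs_bias_le [IsProbabilityMeasure P] (hE : IsEnvironment B X P)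
    (hγ0 : 0 < γ) (hγ1 : γ < 1) {T m t : ℕ} (htT : t < T) (hs : ¬ IsStale X P T m t) (i : Fin K)
    (ω : Ω) :
    |∑ s ∈ Finset.Icc 1 t,
      (if I s ω = i then γ ^ (t - s) * (mean X P s i - mean X P (t + 1) i) else 0)| ≤
      B * (γ ^ m / (1 - γ)) := by
  have hμ := hE.mean_mem_Icc (Nat.le_add_left 1 t) i
  have hB : 0 ≤ B := hμ.1.trans hμ.2
  refine (Finset.abs_sum_le_sum_abs _ _).trans ?_
  calc _ ≤ ∑ s ∈ Finset.Icc 1 t, B * (if s + m ≤ t then γ ^ (t - s) else 0) := by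
        refine Finset.sum_le_sum fun s hs' => ?_
        rw [Finset.mem_Icc] at hs'
        have hp := pow_pos hγ0 (t - s)
        by_cases hsm : s + m ≤ t
        · rw [if_pos hsm]
          have hμs := hE.mean_mem_Icc hs'.1 i
          have habs : |mean X P s i - mean X P (t + 1) i| ≤ B :=
            abs_le.2 ⟨by linarith [hμs.1, hμ.2], by linarith [hμs.2, hμ.1]⟩
          split_ifs
          · rw [abs_mul, abs_of_pos hp, mul_comm]
            gcongr
          · rw [abs_zero]; positivity
        · rw [hE.mean_eq_of_not_isStale htT hs i hs'.1 (by omega) (by omega)]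
          simp [hsm]
    _ ≤ B * (γ ^ m / (1 - γ)) := by
        rw [← Finset.mul_sum]
        exact mul_le_mul_of_nonneg_left (sum_discounts_of_add_le hγ0 hγ1 t m) hB

/-- Separates the stochastic error from the bias caused by changing means. -/
theorem discMean_sub_mean_mul {t : ℕ} {i : Fin K} {ω : Ω} (hN : 0 < discCount γ I t i ω) :
    (discMean γ X I t i ω - mean X P (t + 1) i) * discCount γ I t i ω =
      discNoise γ X P I t i ω + ∑ s ∈ Finset.Icc 1 t,
        (if I s ω = i then γ ^ (t - s) * (mean X P s i - mean X P (t + 1) i) else 0) := by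
  rw [sub_mul, discMean, div_mul_cancel₀ _ hN.ne', discNoise, discCount, Finset.mul_sum,
    ← Finset.sum_sub_distrib, ← Finset.sum_add_distrib]
  refine Finset.sum_congr rfl fun s _ => ?_
  split_ifs <;> ring

/-- Outside of the event `largeNoise` and long after the last breakpoint, the confidence bound
holds. -/
theorem IsEnvironment.discMean_sub_mean_le [IsProbabilityMeasure P] (hE : IsEnvironment B X P)
    (hB : 0 < B) (hξ : 1 / 2 < ξ) (hγ0 : 0 < γ) (hγ1 : γ < 1) {T m t : ℕ} (htT : t < T)
    (hs : ¬ IsStale X P T m t) (hl : 1 / 2 ≤ Real.log (discTotal γ t))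
    (hm : γ ^ m / (1 - γ) ≤ 6 / 5 * (ξ * Real.log (discTotal γ t))) {i : Fin K} {ω : Ω}
    (hb : ∀ s, 1 ≤ s → X s i ω ∈ Set.Icc 0 B) (hN : 0 < discCount γ I t i ω) {σ : ℝ}
    (hσ : |σ| = 1) (hω : ω ∉ largeNoise B ξ γ X P I σ t i) :
    σ * (discMean γ X I t i ω - mean X P (t + 1) i) ≤ padding B ξ γ I t i ω := by
  have hμ := hE.mean_mem_Icc (Nat.le_add_left 1 t) i
  have hX := discMean_mem_Icc hγ0 hb hN
  have hbias := hE.abs_bias_le (I := I) hγ0 hγ1 htT hs i ω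
  have heq := discMean_sub_mean_mul (P := P) (X := X) hN
  rw [padding, sum_discCount]
  set N := discCount γ I t i ω
  set l := Real.log (discTotal γ t)
  have hξl : 0 < ξ * l := by positivity
  -- For a small count the padding is at least `B` and the bound is trivial. Otherwise `N > 4 ξ l ≥
  -- 1`, as `largeNoise` needs, and `ξ l ≤ √(ξ l N) / 2` turns the bias bound `6/5 B ξ l` into `3/5
  -- B √(ξ l N)`.
  rcases le_or_gt N (4 * (ξ * l)) with h | h
  · have h1 : 1 / 2 ≤ √(ξ * l / N) := by
      refine Real.le_sqrt_of_sq_le ?_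
      rw [le_div_iff₀ hN]
      linarith
    have h2 : |σ * (discMean γ X I t i ω - mean X P (t + 1) i)| ≤ B := by
      rw [abs_mul, hσ, one_mul]
      exact abs_le.2 ⟨by linarith [hX.1, hμ.2], by linarith [hX.2, hμ.1]⟩
    nlinarith [le_abs_self (σ * (discMean γ X I t i ω - mean X P (t + 1) i))]
  · have hN1 : 1 ≤ N := by nlinarith
    have hnoise : σ * discNoise γ X P I t i ω ≤ 7 / 5 * B * √(ξ * l * N) := by
      by_contra! hcon
      exact hω ⟨hN1, hcon⟩
    set b := ∑ s ∈ Finset.Icc 1 t,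
      (if I s ω = i then γ ^ (t - s) * (mean X P s i - mean X P (t + 1) i) else 0)
    have hb1 : σ * b ≤ B * (6 / 5 * (ξ * l)) := by
      calc σ * b ≤ |σ * b| := le_abs_self _
        _ = |b| := by rw [abs_mul, hσ, one_mul]
        _ ≤ _ := hbias.trans (by gcongr)
    have hsq : √(ξ * l * N) = √(ξ * l) * √N := Real.sqrt_mul hξl.le N
    have hsN : √N ^ 2 = N := Real.sq_sqrt hN.le
    have hsl : √(ξ * l) ^ 2 = ξ * l := Real.sq_sqrt hξl.le
    have hsN0 : 0 < √N := Real.sqrt_pos.2 hN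
    have hsl0 : 0 < √(ξ * l) := Real.sqrt_pos.2 hξl
    have h2 : 2 * √(ξ * l) ≤ √N := by
      refine Real.le_sqrt_of_sq_le ?_
      rw [mul_pow, hsl]
      linarith
    have h3 : ξ * l ≤ √(ξ * l) * √N / 2 := by nlinarith
    have h4 : σ * (discMean γ X I t i ω - mean X P (t + 1) i) * N ≤ 2 * B * (√(ξ * l) * √N) := by
      have h5 : σ * (discMean γ X I t i ω - mean X P (t + 1) i) * N =
          σ * discNoise γ X P I t i ω + σ * b := by rw [mul_assoc, heq, mul_add]
      have h6 := mul_le_mul_of_nonneg_left h3 hB.le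
      rw [h5]
      rw [hsq] at hnoise
      linarith
    rw [Real.sqrt_div hξl.le]
    have h5 : 2 * B * (√(ξ * l) / √N) * N = 2 * B * (√(ξ * l) * √N) := by
      rw [← hsN, Real.sqrt_sq hsN0.le]; field_simp
    exact le_of_mul_le_mul_right (h4.trans h5.ge) hN

end Confidence

end NonStatBandit

/-! ### Consequences of the policy and the expected number of bad plays. -/

namespace NonStatBandit

section Policy

variable {K : ℕ} {Ω : Type u} [MeasurableSpace Ω] {B ξ γ : ℝ} {X : ℕ → Fin K → Ω → ℝ}
  {I : ℕ → Ω → Fin K} {P : Measure Ω}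

omit [MeasurableSpace Ω] in
theorem IsDUCB.discCount_pos (hI : IsDUCB B ξ γ X I) (hγ0 : 0 < γ) {t : ℕ} (ht : K ≤ t) (i : Fin K)
    (ω : Ω) : 0 < discCount γ I t i ω := by
  refine Finset.sum_pos' (fun s _ => by positivity) ⟨i + 1, ?_, ?_⟩
  · rw [Finset.mem_Icc]; omega
  · have h : I (i + 1) ω = i := Fin.ext (by rw [hI.init _ (by omega) (by omega)]; simp)
    rw [if_pos h]
    positivity

omit [MeasurableSpace Ω] in
theorem IsDUCB.discCount_eq_zero (hI : IsDUCB B ξ γ X I) {t : ℕ} (ht : t < K) {i : Fin K} {ω : Ω}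
    (h : I (t + 1) ω = i) : discCount γ I t i ω = 0 := by
  refine Finset.sum_eq_zero fun s hs => ?_
  rw [Finset.mem_Icc] at hs
  have h1 := hI.init (t + 1) (by omega) (by omega) ω
  have h2 := hI.init s hs.1 (by omega) ω
  have h3 : I s ω ≠ i := by
    rintro h3
    rw [h] at h1
    rw [h3] at h2
    omega
  simp [h3]

/-- If the confidence bounds of the played arm and of an optimal arm hold, then the played arm is
optimal or has not been played often. -/
theorem IsDUCB.discCount_le (hI : IsDUCB B ξ γ X I) (hB : 0 < B) (hξ : 1 / 2 < ξ) (hγ0 : 0 < γ)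
    (hγ1 : γ < 1) {t : ℕ} (hK : 1 ≤ K) (ht : K ≤ t) {i j : Fin K} {ω : Ω} (hi : I (t + 1) ω = i)
    {Δ : ℝ} (hΔ : 0 < Δ) (hgap : Δ ≤ mean X P (t + 1) j - mean X P (t + 1) i)
    (h1 : 1 * (discMean γ X I t i ω - mean X P (t + 1) i) ≤ padding B ξ γ I t i ω)
    (h2 : -1 * (discMean γ X I t j ω - mean X P (t + 1) j) ≤ padding B ξ γ I t j ω) :
    discCount γ I t i ω ≤ 16 * B ^ 2 * ξ * Real.log (1 / (1 - γ)) / Δ ^ 2 := by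
  have hN := hI.discCount_pos hγ0 ht i ω
  have hmax := hI.argmax t ht ω j
  rw [hi] at hmax
  have h3 : Δ ≤ 2 * padding B ξ γ I t i ω := by linarith
  rw [padding, sum_discCount] at h3
  have hn := one_le_discTotal hγ0 hγ1 (hK.trans ht)
  have hl : 0 ≤ Real.log (discTotal γ t) := Real.log_nonneg hn
  have hle : Real.log (discTotal γ t) ≤ Real.log (1 / (1 - γ)) :=
    Real.log_le_log (by linarith) (discTotal_le hγ0 hγ1 t)
  have h4 : Δ ^ 2 ≤ 16 * B ^ 2 * (ξ * Real.log (discTotal γ t) / discCount γ I t i ω) := by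
    have hsq := Real.sq_sqrt (show 0 ≤ ξ * Real.log (discTotal γ t) / discCount γ I t i ω by
      positivity)
    have := pow_le_pow_left₀ hΔ.le h3 2
    nlinarith
  rw [le_div_iff₀ (by positivity)]
  calc discCount γ I t i ω * Δ ^ 2 ≤ discCount γ I t i ω *
        (16 * B ^ 2 * (ξ * Real.log (discTotal γ t) / discCount γ I t i ω)) := by gcongr
    _ = 16 * B ^ 2 * ξ * Real.log (discTotal γ t) := by field_simp
    _ ≤ _ := by gcongr

/-- Number of rounds after a breakpoint in which the empirical averages may be unreliable. -/
noncomputable def staleRounds (ξ γ : ℝ) (K : ℕ) : ℝ :=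
  Real.log ((1 - γ) * ξ * Real.log (discTotal γ K)) / Real.log γ

theorem half_le_log_discTotal (hγ : 5 / 6 ≤ γ) (hγ1 : γ < 1) {t : ℕ} (ht : 2 ≤ t) :
    1 / 2 ≤ Real.log (discTotal γ t) := by
  have h := one_add_le_discTotal (by linarith) hγ1 ht
  rw [Real.le_log_iff_exp_le (by linarith)]
  have h1 : Real.exp (1 / 2) ^ 2 = Real.exp 1 := by rw [← Real.exp_nat_mul]; norm_num
  have h2 := Real.exp_one_lt_d9
  have h3 := Real.exp_pos (1 / 2)
  nlinarith

/-- `γ ^ staleRounds` equals `(1 - γ) ξ log n_K`. Rounding down costs at most a factor `1 / γ ≤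
6/5`; this is where `γ ≥ 5/6` and the constant `6/5` come from. -/
theorem pow_floor_staleRounds_le (hξ : 1 / 2 < ξ) (hγ : 5 / 6 ≤ γ) (hγ1 : γ < 1) (hK : 2 ≤ K)
    {t : ℕ} (ht : K ≤ t) :
    γ ^ ⌊staleRounds ξ γ K⌋₊ / (1 - γ) ≤ 6 / 5 * (ξ * Real.log (discTotal γ t)) := by
  have hγ0 : 0 < γ := by linarith
  have he : 0 < 1 - γ := by linarith
  have hl := half_le_log_discTotal hγ hγ1 hK
  have hlt : Real.log (discTotal γ K) ≤ Real.log (discTotal γ t) :=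
    Real.log_le_log (by linarith [one_le_discTotal hγ0 hγ1 (show 1 ≤ K by omega)])
      (discTotal_mono hγ0 hγ1 ht)
  have hlog : Real.log γ < 0 := Real.log_neg hγ0 hγ1
  set w := (1 - γ) * ξ * Real.log (discTotal γ K) with hw
  have hw0 : 0 < w := by positivity
  have hD : staleRounds ξ γ K * Real.log γ = Real.log w := by
    rw [staleRounds, div_mul_cancel₀ _ hlog.ne]
  have hm := Nat.lt_floor_add_one (staleRounds ξ γ K)
  have h1 : γ ^ ⌊staleRounds ξ γ K⌋₊ * γ ≤ w := by
    rw [← pow_succ, ← Real.log_le_log_iff (by positivity) hw0, Real.log_pow, ← hD]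
    push_cast
    nlinarith
  rw [div_le_iff₀ he]
  have h2 : 0 < γ ^ ⌊staleRounds ξ γ K⌋₊ := by positivity
  calc γ ^ ⌊staleRounds ξ γ K⌋₊ ≤ 6 / 5 * w := by nlinarith
    _ ≤ 6 / 5 * ((1 - γ) * ξ * Real.log (discTotal γ t)) := by rw [hw]; gcongr
    _ = _ := by ring

open Classical in
/-- Pathwise bound on the number of plays of arm `i` while it is not optimal. -/
theorem badPlays_le_sum [IsProbabilityMeasure P] (hK : 2 ≤ K) (hB : 0 < B) (hξ : 1 / 2 < ξ)
    (hγ : 5 / 6 ≤ γ) (hγ1 : γ < 1) (hE : IsEnvironment B X P) (hI : IsDUCB B ξ γ X I) (T : ℕ)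
    (i : Fin K) {Δ : ℝ} (hΔ : 0 < Δ)
    (hgap : ∀ t ∈ Finset.Icc 1 T, mean X P t i < bestMean X P t →
      Δ ≤ bestMean X P t - mean X P t i)
    {j : ℕ → Fin K} (hj : ∀ t, mean X P (t + 1) (j t) = bestMean X P (t + 1)) {ω : Ω}
    (hb : ∀ s, 1 ≤ s → ∀ i, X s i ω ∈ Set.Icc 0 B) :
    badPlays X P I T i ω ≤
      ∑ t ∈ Finset.range T, (if I (t + 1) ω = i ∧ discCount γ I t i ω ≤
        16 * B ^ 2 * ξ * Real.log (1 / (1 - γ)) / Δ ^ 2 then (1 : ℝ) else 0) +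
      ∑ t ∈ Finset.range T, (if IsStale X P T ⌊staleRounds ξ γ K⌋₊ t then (1 : ℝ) else 0) +
      ∑ t ∈ Finset.range T with 1 ≤ t, ((largeNoise B ξ γ X P I 1 t i).indicator 1 ω +
        (largeNoise B ξ γ X P I (-1) t (j t)).indicator 1 ω) := by
  have hγ0 : 0 < γ := by linarith
  rw [badPlays, sum_Icc_one_eq_sum_range, Finset.sum_filter, ← Finset.sum_add_distrib,
    ← Finset.sum_add_distrib]
  refine Finset.sum_le_sum fun t ht => ?_
  rw [Finset.mem_range] at ht
  have hind : ∀ s : Set Ω, 0 ≤ s.indicator (1 : Ω → ℝ) ω := fun s =>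
    Set.indicator_nonneg (fun _ _ => zero_le_one) ω
  have hind1 : ∀ s : Set Ω, ω ∈ s → s.indicator (1 : Ω → ℝ) ω = 1 := fun s hs => by simp [hs]
  have h3 := hind (largeNoise B ξ γ X P I 1 t i)
  have h4 := hind (largeNoise B ξ γ X P I (-1) t (j t))
  have hnn : ∀ (p : Prop) [Decidable p], (0 : ℝ) ≤ if p then 1 else 0 := fun p _ => by split_ifs <;> norm_num
  have h5 : 0 ≤ if 1 ≤ t then (largeNoise B ξ γ X P I 1 t i).indicator (1 : Ω → ℝ) ω +
        (largeNoise B ξ γ X P I (-1) t (j t)).indicator (1 : Ω → ℝ) ω else 0 := by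
    split_ifs <;> linarith
  by_cases hbad : I (t + 1) ω = i ∧ mean X P (t + 1) i < bestMean X P (t + 1)
  swap
  · rw [if_neg hbad]
    exact add_nonneg (add_nonneg (hnn _) (hnn _)) h5
  rw [if_pos hbad]
  by_cases hc : I (t + 1) ω = i ∧ discCount γ I t i ω ≤
      16 * B ^ 2 * ξ * Real.log (1 / (1 - γ)) / Δ ^ 2
  · rw [if_pos hc]
    have := hnn (IsStale X P T ⌊staleRounds ξ γ K⌋₊ t)
    linarith
  -- A play during initialization is the first play of that arm: its count is `0`, so it belongs to
  -- the rarely played case.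
  have hKt : K ≤ t := by
    by_contra! h
    refine hc ⟨hbad.1, ?_⟩
    rw [hI.discCount_eq_zero h hbad.1]
    have : 0 ≤ Real.log (1 / (1 - γ)) := Real.log_nonneg (by
      rw [le_div_iff₀ (by linarith)]; linarith)
    positivity
  rw [if_neg hc]
  by_cases hst : IsStale X P T ⌊staleRounds ξ γ K⌋₊ t
  · rw [if_pos hst]; linarith
  rw [if_neg hst, if_pos (by omega)]
  by_contra! hcon
  have hl := half_le_log_discTotal hγ hγ1 (hK.trans hKt)
  have hm := pow_floor_staleRounds_le hξ hγ hγ1 hK hKt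
  have hn1 : ω ∉ largeNoise B ξ γ X P I 1 t i := fun h => by
    rw [hind1 _ h] at hcon; linarith
  have hn2 : ω ∉ largeNoise B ξ γ X P I (-1) t (j t) := fun h => by
    rw [hind1 _ h] at hcon; linarith
  refine hc ⟨hbad.1, hI.discCount_le hB hξ hγ0 hγ1 (by omega) hKt (j := j t) hbad.1 hΔ ?_
    (hE.discMean_sub_mean_le hB hξ hγ0 hγ1 ht hst hl hm (fun s hs => hb s hs _)
      (hI.discCount_pos hγ0 hKt _ ω) (by simp) hn1)
    (hE.discMean_sub_mean_le hB hξ hγ0 hγ1 ht hst hl hm (fun s hs => hb s hs _)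
      (hI.discCount_pos hγ0 hKt _ ω) (by simp) hn2)⟩
  rw [hj]
  exact hgap (t + 1) (by rw [Finset.mem_Icc]; omega) hbad.2

theorem sum_inv_discTotal_le (hγ0 : 0 < γ) (hγ1 : γ < 1) (T : ℕ) :
    ∑ t ∈ Finset.range T with 1 ≤ t, 1 / discTotal γ t ≤ 1 + Real.log T + T * (1 - γ) := by
  have he : 0 < 1 - γ := by linarith
  have h1 : ∑ t ∈ Finset.range T with 1 ≤ t, 1 / discTotal γ t ≤
      ∑ t ∈ Finset.range T, (1 / (t : ℝ) + (1 - γ)) := by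
    refine (Finset.sum_le_sum fun t ht =>
      inv_discTotal_le hγ0 hγ1 (Finset.mem_filter.1 ht).2).trans ?_
    exact Finset.sum_le_sum_of_subset_of_nonneg (Finset.filter_subset _ _)
      fun t _ _ => by positivity
  have h2 : ∑ t ∈ Finset.range T, 1 / (t : ℝ) ≤ harmonic T := by
    -- The term `t = 0` is `1 / 0 = 0`.
    have := Finset.sum_range_succ' (fun t : ℕ => 1 / (t : ℝ)) T
    rw [Finset.sum_range_succ] at this
    have hT : (0 : ℝ) ≤ 1 / (T : ℝ) := by positivity
    rw [harmonic]
    push_cast at this ⊢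
    simp only [one_div, inv_zero, add_zero] at this hT ⊢
    linarith
  have h3 := harmonic_le_one_add_log T
  rw [Finset.sum_add_distrib, Finset.sum_const, Finset.card_range, nsmul_eq_mul] at h1
  linarith

/-- Bound on the expected number of plays of arm `i` while it is not optimal, for a discount factor
close to one. -/
theorem integral_badPlays_le [IsProbabilityMeasure P] (hK : 2 ≤ K) (hB : 0 < B) (hξ : 1 / 2 < ξ)
    (hγ : 5 / 6 ≤ γ) (hγ1 : γ < 1) (hE : IsEnvironment B X P) (hI : IsDUCB B ξ γ X I) (T : ℕ)
    (i : Fin K) {Δ : ℝ} (hΔ : 0 < Δ)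
    (hgap : ∀ t ∈ Finset.Icc 1 T, mean X P t i < bestMean X P t →
      Δ ≤ bestMean X P t - mean X P t i) :
    ∫ ω, badPlays X P I T i ω ∂P ≤
      (16 * B ^ 2 * ξ * Real.log (1 / (1 - γ)) / Δ ^ 2 + 1) * (1 + T * (1 - γ)) +
      max (staleRounds ξ γ K) 0 * numBreakpoints X P T +
      3 * (1 + Real.log T + T * (1 - γ)) := by
  classical
  have hγ0 : 0 < γ := by linarith
  choose j hj using fun t => exists_mean_eq_bestMean (X := X) (P := P) (by omega : 0 < K) (t + 1)
  set A := 16 * B ^ 2 * ξ * Real.log (1 / (1 - γ)) / Δ ^ 2 with hA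
  have hA0 : 0 ≤ A := by
    have : 0 ≤ Real.log (1 / (1 - γ)) := Real.log_nonneg (by
      rw [le_div_iff₀ (by linarith)]; linarith)
    positivity
  have hm : (⌊staleRounds ξ γ K⌋₊ : ℝ) ≤ max (staleRounds ξ γ K) 0 := by
    rcases le_total 0 (staleRounds ξ γ K) with h | h
    · exact (Nat.floor_le h).trans (le_max_left _ _)
    · simp [Nat.floor_of_nonpos h]
  set c := (A + 1) * (1 + T * (1 - γ)) + max (staleRounds ξ γ K) 0 * numBreakpoints X P T with hc
  let N : ℕ → Ω → ℝ := fun t ω => (largeNoise B ξ γ X P I 1 t i).indicator 1 ω +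
    (largeNoise B ξ γ X P I (-1) t (j t)).indicator 1 ω
  have hbd : ∀ᵐ ω ∂P, badPlays X P I T i ω ≤ c + ∑ t ∈ Finset.range T with 1 ≤ t, N t ω := by
    have hb : ∀ᵐ ω ∂P, ∀ s, 1 ≤ s → ∀ i, X s i ω ∈ Set.Icc 0 B := by
      rw [ae_all_iff]
      intro s
      by_cases hs : 1 ≤ s
      · simpa [hs, ae_all_iff] using hE.bounded s hs
      · simp [hs]
    filter_upwards [hb] with ω hω
    refine (badPlays_le_sum hK hB hξ hγ hγ1 hE hI T i hΔ hgap hj hω).trans ?_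
    have h1 := sum_plays_of_discCount_le (I := I) hγ0 hγ1 hA0 i ω T
    have h2 := (sum_isStale_le (X := X) (P := P) T ⌊staleRounds ξ γ K⌋₊).trans
      (mul_le_mul_of_nonneg_right hm (Nat.cast_nonneg _))
    rw [hc]
    gcongr
  have hms := fun σ t a => measurableSet_largeNoise hE hI (P := P) σ t a
  have hint : ∀ σ t a, Integrable ((largeNoise B ξ γ X P I σ t a).indicator (1 : Ω → ℝ)) P :=
    fun σ t a => (integrable_const (1 : ℝ)).indicator (hms σ t a)
  have hN : ∀ t ∈ (Finset.range T).filter (1 ≤ ·), Integrable (N t) P := fun t _ =>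
    (hint _ _ _).add (hint _ _ _)
  have hNint : ∀ t ∈ (Finset.range T).filter (1 ≤ ·),
      ∫ ω, N t ω ∂P ≤ 3 * (1 / discTotal γ t) := fun t ht => by
    have ht1 := (Finset.mem_filter.1 ht).2
    rw [integral_add (hint _ _ _) (hint _ _ _), integral_indicator_one (hms _ _ _),
      integral_indicator_one (hms _ _ _)]
    have h1 := measureReal_largeNoise_le (σ := 1) hB hξ hγ0 hγ1 hE hI (by norm_num) ht1 i
    have h2 := measureReal_largeNoise_le (σ := -1) hB hξ hγ0 hγ1 hE hI (by norm_num) ht1 (j t)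
    calc _ ≤ 3 / 2 / discTotal γ t + 3 / 2 / discTotal γ t := add_le_add h1 h2
      _ = 3 * (1 / discTotal γ t) := by ring
  calc ∫ ω, badPlays X P I T i ω ∂P
      ≤ ∫ ω, (c + ∑ t ∈ Finset.range T with 1 ≤ t, N t ω) ∂P :=
        integral_mono_of_nonneg (Filter.Eventually.of_forall (badPlays_nonneg T i))
          ((integrable_const c).add (integrable_finsetSum _ hN)) hbd
    _ = c + ∑ t ∈ Finset.range T with 1 ≤ t, ∫ ω, N t ω ∂P := by
        rw [integral_add (integrable_const c) (integrable_finsetSum _ hN),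
          integral_finsetSum _ hN]
        simp
    _ ≤ c + ∑ t ∈ Finset.range T with 1 ≤ t, 3 * (1 / discTotal γ t) := by
        gcongr with t ht
        exact hNint t ht
    _ ≤ c + 3 * (1 + Real.log T + T * (1 - γ)) := by
        rw [← Finset.mul_sum]
        gcongr
        exact sum_inv_discTotal_le hγ0 hγ1 T

end Policy

end NonStatBandit

/-! ### Comparison with the constants `B(γ)` and `C(γ)`. -/

namespace NonStatBandit

section Constants

variable {B ξ γ : ℝ}

theorem rpow_one_div_le (hγ0 : 0 < γ) (hγ1 : γ < 1) : γ ^ (1 / (1 - γ)) ≤ Real.exp (-1) := by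
  have he : 0 < 1 - γ := by linarith
  rw [Real.rpow_def_of_pos hγ0, Real.exp_le_exp, mul_one_div, div_le_iff₀ he]
  linarith [Real.log_le_sub_one_of_pos hγ0]

/-- The prefactor of `constC` cancels the logarithm and `1 / (1 - γ)`, so the second term of the
bound is exactly the cost of the stale rounds. -/
theorem constC_mul (hγ0 : 0 < γ) (hγ1 : γ < 1) (K : ℕ) (U : ℝ) :
    max (constC ξ γ K) 0 * (U / (1 - γ)) * Real.log (1 / (1 - γ)) =
      max (staleRounds ξ γ K) 0 * U := by
  have he : 0 < 1 - γ := by linarith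
  have hle : Real.log (1 - γ) < 0 := Real.log_neg he (by linarith)
  have hlγ : Real.log γ < 0 := Real.log_neg hγ0 hγ1
  have hL : Real.log (1 / (1 - γ)) = -Real.log (1 - γ) := by rw [one_div, Real.log_inv]
  have hpos : 0 ≤ -Real.log (1 - γ) / (1 - γ) := div_nonneg (by linarith) he.le
  have h1 : constC ξ γ K * (-Real.log (1 - γ) / (1 - γ)) = staleRounds ξ γ K := by
    rw [constC, staleRounds]
    have := hle.ne
    have := hlγ.ne
    have := he.ne'
    field_simp
    ring
  rw [hL, ← h1]
  conv_rhs => rw [← zero_mul (-Real.log (1 - γ) / (1 - γ)), ← max_mul_of_nonneg _ _ hpos]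
  ring

theorem constB_mul (hγ0 : 0 < γ) (hγ1 : γ < 1) {T : ℕ} (hT : 1 ≤ T) (Δ : ℝ) :
    constB B ξ γ T Δ * T * (1 - γ) * Real.log (1 / (1 - γ)) =
      16 * B ^ 2 * ξ * Real.log (1 / (1 - γ)) / Δ ^ 2 / γ ^ (1 / (1 - γ)) * ⌈(T : ℝ) * (1 - γ)⌉ +
      2 * ⌈Real.log (1 / (1 - γ)) / Real.log (1 + 4 * √(1 - 1 / (2 * ξ)))⌉ /
        (1 - γ ^ (1 / (1 - γ))) * (T * (1 - γ)) := by
  have he : 0 < 1 - γ := by linarith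
  have hTpos : (0 : ℝ) < T := by exact_mod_cast hT
  have hL : Real.log (1 / (1 - γ)) = -Real.log (1 - γ) := by rw [one_div, Real.log_inv]
  have hLpos : -Real.log (1 - γ) ≠ 0 := (neg_pos.2 (Real.log_neg he (by linarith))).ne'
  rw [constB, hL]
  generalize -Real.log (1 - γ) = L at *
  generalize γ ^ (1 / (1 - γ)) = G
  generalize (⌈(T : ℝ) * (1 - γ)⌉ : ℝ) = r
  generalize (⌈L / Real.log (1 + 4 * √(1 - 1 / (2 * ξ)))⌉ : ℝ) = c
  have := he.ne'
  have := hTpos.ne'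
  have e1 : 16 * B ^ 2 * ξ / (G * Δ ^ 2) * (r / (T * (1 - γ))) * T * (1 - γ) * L =
      16 * B ^ 2 * ξ * L / Δ ^ 2 / G * r := by
    rw [div_div, mul_comm (Δ ^ 2) G, div_mul_div_comm, div_mul_eq_mul_div, div_mul_eq_mul_div,
      div_mul_eq_mul_div, div_mul_eq_mul_div, mul_comm (G * Δ ^ 2)]
    rw [show 16 * B ^ 2 * ξ * r * T * (1 - γ) * L = (T * (1 - γ)) * (16 * B ^ 2 * ξ * L * r) by ring,
      mul_div_mul_left _ _ (by positivity)]
  have e2 : 2 * c / (L * (1 - G)) * T * (1 - γ) * L = 2 * c / (1 - G) * (T * (1 - γ)) := by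
    rw [mul_comm L, ← div_div]
    field_simp
  rw [add_mul, add_mul, add_mul, e1, e2]

theorem log_one_add_four_mul_sqrt_pos (hξ : 1 / 2 < ξ) :
    0 < Real.log (1 + 4 * √(1 - 1 / (2 * ξ))) := by
  refine Real.log_pos ?_
  have : 0 < √(1 - 1 / (2 * ξ)) := by
    refine Real.sqrt_pos.2 ?_
    rw [sub_pos, div_lt_one (by linarith)]
    linarith
  linarith

theorem le_constB_mul (hξ : 1 / 2 < ξ) (hγ0 : 0 < γ) (hγ1 : γ < 1) {T : ℕ} (hT : 1 ≤ T) (Δ : ℝ) :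
    16 * B ^ 2 * ξ * Real.log (1 / (1 - γ)) / Δ ^ 2 / γ ^ (1 / (1 - γ)) * ⌈(T : ℝ) * (1 - γ)⌉ ≤
      constB B ξ γ T Δ * T * (1 - γ) * Real.log (1 / (1 - γ)) := by
  have he : 0 < 1 - γ := by linarith
  rw [constB_mul hγ0 hγ1 hT]
  refine le_add_of_nonneg_right ?_
  have h1 := log_one_add_four_mul_sqrt_pos hξ
  have hL : 0 ≤ Real.log (1 / (1 - γ)) := Real.log_nonneg (by
    rw [le_div_iff₀ he]; linarith)
  have h2 : (0 : ℝ) ≤ ⌈Real.log (1 / (1 - γ)) / Real.log (1 + 4 * √(1 - 1 / (2 * ξ)))⌉ := by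
    exact_mod_cast Int.ceil_nonneg (by positivity)
  have h3 : 0 ≤ 1 - γ ^ (1 / (1 - γ)) := by
    have := Real.rpow_le_one hγ0.le hγ1.le (z := 1 / (1 - γ)) (by positivity)
    linarith
  positivity

/-- Here `108/5 = 8 * 27/10`, with `27/10` a lower bound for `e`. The proof uses `exp L ≤ 43 < 108/5
* 2`. -/
theorem exp_le_of_mem {L : ℝ} (h1 : 2 ≤ L) (h2 : L ≤ 7 / 2) : Real.exp L ≤ 108 / 5 * L := by
  have h3 : Real.exp (7 / 2) ≤ 43 := by
    have h : Real.exp (7 / 2) ^ 2 = Real.exp 1 ^ 7 := by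
      rw [← Real.exp_nat_mul, ← Real.exp_nat_mul]; norm_num
    have h' : Real.exp 1 ^ 7 ≤ 43 ^ 2 :=
      (pow_le_pow_left₀ (Real.exp_pos 1).le Real.exp_one_lt_d9.le 7).trans (by norm_num)
    exact (pow_le_pow_iff_left₀ (Real.exp_pos _).le (by norm_num) (by norm_num : (2 : ℕ) ≠ 0)).1
      (h.trans_le h')
  linarith [Real.exp_le_exp.2 h2]

/-- If the discount factor is not close to one, the first term of the bound exceeds the horizon. -/
theorem horizon_le (hγ0 : 0 < γ) (hγ1 : γ < 1) (hL : Real.log (1 / (1 - γ)) ≤ 7 / 2) {A : ℝ}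
    (hA : 8 * Real.log (1 / (1 - γ)) ≤ A) (T : ℕ) :
    T ≤ A / γ ^ (1 / (1 - γ)) * ⌈(T : ℝ) * (1 - γ)⌉ := by
  have he : 0 < 1 - γ := by linarith
  have hG : 0 < γ ^ (1 / (1 - γ)) := Real.rpow_pos_of_pos hγ0 _
  have hceil := Int.le_ceil ((T : ℝ) * (1 - γ))
  have hexp : Real.exp (Real.log (1 / (1 - γ))) = 1 / (1 - γ) := Real.exp_log (by positivity)
  suffices h : 1 / (1 - γ) ≤ A / γ ^ (1 / (1 - γ)) by
    calc (T : ℝ) = 1 / (1 - γ) * (T * (1 - γ)) := by field_simp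
      _ ≤ _ := mul_le_mul h hceil (by positivity) (le_trans (by positivity) h)
  rw [le_div_iff₀ hG]
  -- If `γ ≤ 7/8`, then `1 / (1 - γ) ≤ 8` and `γ ^ (1 / (1 - γ)) ≤ γ ≤ log (1 / (1 - γ))`. Otherwise
  -- the logarithm is at least `2` and `exp_le_of_mem` applies.
  rcases le_or_gt (1 / 8) (1 - γ) with h | h
  · have h1 : γ ^ (1 / (1 - γ)) ≤ γ := by
      conv_rhs => rw [← Real.rpow_one γ]
      exact Real.rpow_le_rpow_of_exponent_ge hγ0 hγ1.le (by rw [le_div_iff₀ he]; linarith)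
    have h2 : γ ≤ Real.log (1 / (1 - γ)) := by
      rw [one_div, Real.log_inv]
      linarith [Real.log_le_sub_one_of_pos he]
    have h3 : 1 / (1 - γ) ≤ 8 := by rw [div_le_iff₀ he]; linarith
    nlinarith
  · have h1 := rpow_one_div_le hγ0 hγ1
    have h2 : Real.exp (-1) ≤ 10 / 27 := by
      rw [Real.exp_neg, inv_le_comm₀ (Real.exp_pos 1) (by norm_num)]
      linarith [Real.exp_one_gt_d9]
    have h3 : 2 ≤ Real.log (1 / (1 - γ)) := by
      rw [Real.le_log_iff_exp_le (by positivity), show (2 : ℝ) = 2 * 1 by norm_num, two_mul,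
        Real.exp_add]
      have : 8 < 1 / (1 - γ) := by rw [lt_div_iff₀ he]; linarith
      nlinarith [Real.exp_one_lt_d9, Real.exp_pos 1]
    have h4 := exp_le_of_mem h3 hL
    rw [hexp] at h4
    have h5 : 0 < 1 / (1 - γ) := by positivity
    nlinarith

/-- With `c = ⌈T (1 - γ)⌉`, the left side is at most `2 A c + 8 c + 3 L c` and the right side at
least `2.7 A c`. As `A ≥ 8 L`, it suffices that `8 ≤ 2.6 L`, which `L ≥ 7/2` ensures. -/
theorem slack_le (hγ0 : 0 < γ) (hγ1 : γ < 1) (hL : 7 / 2 ≤ Real.log (1 / (1 - γ))) {A : ℝ}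
    (hA : 8 * Real.log (1 / (1 - γ)) ≤ A) {T : ℕ} (hT : 1 ≤ T) :
    (A + 1) * (1 + T * (1 - γ)) + 3 * (1 + Real.log T + T * (1 - γ)) ≤
      A / γ ^ (1 / (1 - γ)) * ⌈(T : ℝ) * (1 - γ)⌉ := by
  have he : 0 < 1 - γ := by linarith
  have hTpos : (0 : ℝ) < T := by exact_mod_cast hT
  have hceil := Int.le_ceil ((T : ℝ) * (1 - γ))
  have hceil1 : (1 : ℝ) ≤ ⌈(T : ℝ) * (1 - γ)⌉ := by
    exact_mod_cast Int.one_le_ceil_iff.2 (by positivity)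
  have hG : 0 < γ ^ (1 / (1 - γ)) := Real.rpow_pos_of_pos hγ0 _
  have hlogT : Real.log T ≤ T * (1 - γ) - 1 + Real.log (1 / (1 - γ)) := by
    have h1 : Real.log T = Real.log (T * (1 - γ)) + Real.log (1 / (1 - γ)) := by
      rw [← Real.log_mul (by positivity) (by positivity)]
      congr 1
      field_simp
    linarith [Real.log_le_sub_one_of_pos (show 0 < T * (1 - γ) by positivity)]
  have hAG : 27 / 10 * A ≤ A / γ ^ (1 / (1 - γ)) := by
    rw [le_div_iff₀ hG]
    have h1 := rpow_one_div_le hγ0 hγ1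
    have h2 : Real.exp (-1) ≤ 10 / 27 := by
      rw [Real.exp_neg, inv_le_comm₀ (Real.exp_pos 1) (by norm_num)]
      linarith [Real.exp_one_gt_d9]
    nlinarith
  set L := Real.log (1 / (1 - γ))
  set r := (T : ℝ) * (1 - γ)
  set c : ℝ := ((⌈r⌉ : ℤ) : ℝ)
  have h1 : 27 / 10 * A * c ≤ A / γ ^ (1 / (1 - γ)) * c := by gcongr
  have h2 : (A + 1) * (1 + r) ≤ (A + 1) * (2 * c) := by
    have : 0 ≤ A + 1 := by linarith
    gcongr
    linarith
  have h3 : L ≤ L * c := by nlinarith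
  have h4 : 8 * L * c ≤ A * c := by gcongr
  have h5 : 7 / 2 * c ≤ L * c := by gcongr
  linarith

end Constants

variable {K : ℕ} {Ω : Type u} [MeasurableSpace Ω] {B ξ γ : ℝ} {X : ℕ → Fin K → Ω → ℝ}
  {I : ℕ → Ω → Fin K} {P : Measure Ω}

/-- Explicit bound on the expected number of plays of arm `i` while it is not optimal. -/
theorem integral_badPlays_le_constB_add_constC [IsProbabilityMeasure P] (hK : 2 ≤ K) (hB : 0 < B)
    (hξ : 1 / 2 < ξ) (hγ0 : 0 < γ) (hγ1 : γ < 1) {T : ℕ} (hT : 1 ≤ T) (hE : IsEnvironment B X P)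
    (hI : IsDUCB B ξ γ X I) (i : Fin K) :
    ∫ ω, badPlays X P I T i ω ∂P ≤
      constB B ξ γ T (minGap X P T i) * T * (1 - γ) * Real.log (1 / (1 - γ)) +
        max (constC ξ γ K) 0 * (numBreakpoints X P T / (1 - γ)) * Real.log (1 / (1 - γ)) := by
  have he : 0 < 1 - γ := by linarith
  have hL : 0 < Real.log (1 / (1 - γ)) := Real.log_pos (by rw [lt_div_iff₀ he]; linarith)
  have hG : 0 < γ ^ (1 / (1 - γ)) := Real.rpow_pos_of_pos hγ0 _
  have hceil : (0 : ℝ) ≤ ⌈(T : ℝ) * (1 - γ)⌉ := by exact_mod_cast Int.ceil_nonneg (by positivity)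
  rw [constC_mul hγ0 hγ1]
  have hC : 0 ≤ max (staleRounds ξ γ K) 0 * numBreakpoints X P T := by positivity
  have hBle := le_constB_mul (B := B) hξ hγ0 hγ1 hT (minGap X P T i)
  by_cases h : ∃ t ∈ Finset.Icc 1 T, mean X P t i < bestMean X P t
  swap
  · simp only [badPlays_eq_zero h, integral_zero]
    have : 0 ≤ 16 * B ^ 2 * ξ * Real.log (1 / (1 - γ)) / minGap X P T i ^ 2 / γ ^ (1 / (1 - γ)) *
      ⌈(T : ℝ) * (1 - γ)⌉ := by positivity
    linarith
  obtain ⟨t, ht, hlt⟩ := h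
  obtain ⟨s, hs, hslt, hgap⟩ := exists_minGap_eq ht hlt
  have hΔ0 : 0 < minGap X P T i := by linarith
  have hΔB : minGap X P T i ≤ B := by
    obtain ⟨j, hj⟩ := exists_mean_eq_bestMean (X := X) (P := P) (by omega : 0 < K) s
    have h1 := hE.mean_mem_Icc (Finset.mem_Icc.1 hs).1 j
    have h2 := hE.mean_mem_Icc (Finset.mem_Icc.1 hs).1 i
    linarith [h1.2, h2.1]
  -- Gaps never exceed `B`, and `ξ > 1/2`.
  have hA : 8 * Real.log (1 / (1 - γ)) ≤
      16 * B ^ 2 * ξ * Real.log (1 / (1 - γ)) / minGap X P T i ^ 2 := by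
    rw [le_div_iff₀ (by positivity)]
    have h1 : minGap X P T i ^ 2 ≤ B ^ 2 := by gcongr
    calc 8 * Real.log (1 / (1 - γ)) * minGap X P T i ^ 2
        ≤ 8 * Real.log (1 / (1 - γ)) * B ^ 2 := by gcongr
      _ = 16 * B ^ 2 * (1 / 2) * Real.log (1 / (1 - γ)) := by ring
      _ ≤ _ := by gcongr
  rcases le_total (Real.log (1 / (1 - γ))) (7 / 2) with h | h
  · have h1 := horizon_le hγ0 hγ1 h hA T
    have h2 : ∫ ω, badPlays X P I T i ω ∂P ≤ ∫ _, (T : ℝ) ∂P :=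
      integral_mono_of_nonneg (Filter.Eventually.of_forall (badPlays_nonneg T i))
        (integrable_const _) (Filter.Eventually.of_forall (badPlays_le T i))
    rw [integral_const, probReal_univ, one_smul] at h2
    linarith
  · have hγ : 5 / 6 ≤ γ := by
      rw [Real.le_log_iff_exp_le (by positivity), le_div_iff₀ he] at h
      have h1 : 6 ≤ Real.exp (7 / 2) := by
        have h2 : Real.exp 1 * Real.exp 1 ≤ Real.exp (7 / 2) := by
          rw [← Real.exp_add]; exact Real.exp_le_exp.2 (by norm_num)
        nlinarith [Real.exp_one_gt_d9]
      nlinarith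
    have h1 := slack_le hγ0 hγ1 h hA hT
    have h2 := integral_badPlays_le hK hB hξ hγ hγ1 hE hI T i hΔ0 fun t ht hlt => minGap_le ht hlt
    linarith

end NonStatBandit

/-! ### Regret in terms of bad plays. -/

namespace NonStatBandit

section Regret

variable {K : ℕ} {Ω : Type u} [MeasurableSpace Ω] {B ξ γ : ℝ} {X : ℕ → Fin K → Ω → ℝ}
  {I : ℕ → Ω → Fin K} {P : Measure Ω}

theorem IsEnvironment.integrable_reward [IsProbabilityMeasure P] (hE : IsEnvironment B X P) {t : ℕ}
    (ht : 1 ≤ t) (i : Fin K) : Integrable (X t i) P :=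
  Integrable.of_mem_Icc 0 B (hE.measurable t ht i).aemeasurable (hE.bounded t ht i)

/-- The played arm is chosen independently of the rewards of the round. -/
theorem integral_indicator_reward [IsProbabilityMeasure P] (hE : IsEnvironment B X P)
    (hI : IsDUCB B ξ γ X I) {t : ℕ} (ht : 1 ≤ t) (i : Fin K) :
    ∫ ω, {ω | I t ω = i}.indicator (X t i) ω ∂P =
      ∫ ω, {ω | I t ω = i}.indicator (fun _ => mean X P t i) ω ∂P := by
  obtain ⟨r, rfl⟩ : ∃ r, t = r + 1 := ⟨t - 1, by omega⟩
  set S : Set Ω := {ω | I (r + 1) ω = i}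
  have hS : MeasurableSet[past X r] S := hI.nonanticipating r (measurableSet_singleton i)
  have hS' := hE.past_le r _ hS
  have hf : Measurable[past X r] (S.indicator (fun _ => (1 : ℝ))) :=
    (@measurable_const _ _ _ (past X r) 1).indicator hS
  have hind : IndepFun (S.indicator (fun _ => (1 : ℝ))) (X (r + 1) i) P :=
    indep_of_indep_of_le_left (hE.indep_past r i) (measurable_iff_comap_le.1 hf)
  have hmul : ∀ g : Ω → ℝ, S.indicator g = fun ω => S.indicator (fun _ => (1 : ℝ)) ω * g ω :=
    fun g => by
      ext ω
      by_cases h : ω ∈ S <;> simp [h]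
  rw [hmul, hmul (fun _ => mean X P (r + 1) i), integral_mul_const]
  exact hind.integral_fun_mul_eq_mul_integral
    (hf.mono (hE.past_le r) le_rfl).aestronglyMeasurable
    (hE.measurable (r + 1) ht i).aestronglyMeasurable

/-- Each round contributes `∑ i, P(I_t = i) (μ_t(best t) - μ_t(i))`. Terms of optimal arms are at
most `0`, all others at most `B P(I_t = i)`. -/
theorem regret_le [IsProbabilityMeasure P] (hE : IsEnvironment B X P) (hI : IsDUCB B ξ γ X I)
    (T : ℕ) (best : ℕ → Fin K) :
    regret X P I best T ≤ B * ∑ i, ∫ ω, badPlays X P I T i ω ∂P := by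
  classical
  have hmeas : ∀ t ∈ Finset.Icc 1 T, ∀ i, MeasurableSet {ω | I t ω = i} := fun t ht i =>
    hI.measurable_arm hE (Finset.mem_Icc.1 ht).1 (measurableSet_singleton i)
  have hsplit : ∀ t ω, X t (I t ω) ω = ∑ i, {ω | I t ω = i}.indicator (X t i) ω := fun t ω => by
    simp [Set.indicator_apply]
  have hint1 : ∀ t ∈ Finset.Icc 1 T, ∀ i, Integrable ({ω | I t ω = i}.indicator (X t i)) P :=
    fun t ht i => (hE.integrable_reward (Finset.mem_Icc.1 ht).1 i).indicator (hmeas t ht i)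
  have hint0 : ∀ t ∈ Finset.Icc 1 T, ∀ i, Integrable ({ω | I t ω = i}.indicator (1 : Ω → ℝ)) P :=
    fun t ht i => (integrable_const (1 : ℝ)).indicator (hmeas t ht i)
  have hint2 : ∀ t ∈ Finset.Icc 1 T, Integrable (fun ω => X t (I t ω) ω) P := fun t ht => by
    simp_rw [hsplit]
    exact integrable_finsetSum _ fun i _ => hint1 t ht i
  have hmean : ∀ t ∈ Finset.Icc 1 T, ∫ ω, X t (I t ω) ω ∂P =
      ∑ i, P.real {ω | I t ω = i} * mean X P t i := fun t ht => by
    simp_rw [hsplit]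
    rw [integral_finsetSum _ fun i _ => hint1 t ht i]
    refine Finset.sum_congr rfl fun i _ => ?_
    rw [integral_indicator_reward hE hI (Finset.mem_Icc.1 ht).1 i,
      integral_indicator_const _ (hmeas t ht i), smul_eq_mul]
  have hone : ∀ t ∈ Finset.Icc 1 T, ∑ i, P.real {ω | I t ω = i} = 1 := fun t ht => by
    have h : ∀ ω, ∑ i, {ω | I t ω = i}.indicator (1 : Ω → ℝ) ω = 1 := fun ω => by
      simp [Set.indicator_apply]
    have h1 : ∫ ω, ∑ i, {ω | I t ω = i}.indicator (1 : Ω → ℝ) ω ∂P = 1 := by simp [h]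
    rw [integral_finsetSum _ fun i _ => hint0 t ht i] at h1
    rw [← h1]
    exact Finset.sum_congr rfl fun i _ => (integral_indicator_one (hmeas t ht i)).symm
  have hbad : ∀ i, ∫ ω, badPlays X P I T i ω ∂P = ∑ t ∈ Finset.Icc 1 T,
      (if mean X P t i < bestMean X P t then P.real {ω | I t ω = i} else 0) := fun i => by
    have h : ∀ ω, badPlays X P I T i ω = ∑ t ∈ Finset.Icc 1 T,
        if mean X P t i < bestMean X P t then {ω | I t ω = i}.indicator (1 : Ω → ℝ) ω else 0 :=
      fun ω => by
        refine Finset.sum_congr rfl fun t _ => ?_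
        by_cases h1 : I t ω = i <;> by_cases h2 : mean X P t i < bestMean X P t <;> simp [h1, h2]
    simp_rw [h]
    rw [integral_finsetSum]
    · refine Finset.sum_congr rfl fun t ht => ?_
      split_ifs
      · exact integral_indicator_one (hmeas t ht i)
      · simp
    · intro t ht
      split_ifs
      · exact hint0 t ht i
      · exact integrable_zero _ _ _
  have hbint : ∀ t ∈ Finset.Icc 1 T, Integrable (X t (best t)) P := fun t ht =>
    hE.integrable_reward (Finset.mem_Icc.1 ht).1 _
  rw [regret, integral_sub (integrable_finsetSum _ hbint) (integrable_finsetSum _ hint2),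
    integral_finsetSum _ hbint, integral_finsetSum _ hint2, ← Finset.sum_sub_distrib]
  simp_rw [hbad]
  rw [Finset.sum_comm, Finset.mul_sum]
  refine Finset.sum_le_sum fun t ht => ?_
  have ht1 := (Finset.mem_Icc.1 ht).1
  rw [hmean t ht, ← one_mul (∫ ω, X t (best t) ω ∂P), ← hone t ht, Finset.sum_mul,
    ← Finset.sum_sub_distrib, Finset.mul_sum]
  refine Finset.sum_le_sum fun i _ => ?_
  change P.real {ω | I t ω = i} * mean X P t (best t) - _ ≤ _
  have hp : 0 ≤ P.real {ω | I t ω = i} := measureReal_nonneg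
  have h1 := (hE.mean_mem_Icc ht1 (best t)).2
  have h2 := (hE.mean_mem_Icc ht1 i).1
  split_ifs with h
  · nlinarith
  · have h3 := mean_le_bestMean (X := X) (P := P) t (best t)
    nlinarith

end Regret

/-! ### Tuned discount factor. -/

section Tuning

variable {B ξ γ : ℝ}

theorem log_inv_le_of_tuned (hB : 0 < B) {T U : ℝ} (hU : 1 ≤ U) (hT : 2 ≤ T) :
    Real.log (1 / ((4 * B)⁻¹ * √(U / T))) ≤ (2 * |Real.log (4 * B)| + 1) * Real.log T := by
  have hT0 : 0 < T := by linarith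
  have hlogT : 1 / 2 ≤ Real.log T := by
    have := Real.log_le_log (by norm_num) hT
    linarith [Real.log_two_gt_d9]
  have hU0 : 0 ≤ Real.log U := Real.log_nonneg hU
  have h : Real.log (1 / ((4 * B)⁻¹ * √(U / T))) =
      Real.log (4 * B) + (Real.log T - Real.log U) / 2 := by
    rw [one_div, Real.log_inv, Real.log_mul (by positivity) (by positivity), Real.log_inv,
      Real.log_sqrt (by positivity), Real.log_div (by positivity) (by positivity)]
    ring
  rw [h]
  nlinarith [le_abs_self (Real.log (4 * B)), abs_nonneg (Real.log (4 * B))]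

theorem one_ninth_le_rpow (hγ : 1 / 2 ≤ γ) (hγ1 : γ < 1) : 1 / 9 ≤ γ ^ (1 / (1 - γ)) := by
  have he : 0 < 1 - γ := by linarith
  have hγ0 : 0 < γ := by linarith
  have h1 : -2 ≤ Real.log γ * (1 / (1 - γ)) := by
    rw [mul_one_div, le_div_iff₀ he]
    have h2 := Real.one_sub_inv_le_log_of_pos hγ0
    have h3 : -2 * (1 - γ) ≤ 1 - γ⁻¹ := by
      rw [show 1 - γ⁻¹ = -(1 - γ) / γ by field_simp; ring, le_div_iff₀ hγ0]
      nlinarith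
    linarith
  rw [Real.rpow_def_of_pos hγ0]
  refine le_trans ?_ (Real.exp_le_exp.2 h1)
  rw [Real.exp_neg, one_div]
  refine inv_anti₀ (Real.exp_pos 2) ?_
  rw [show (2 : ℝ) = 1 + 1 by norm_num, Real.exp_add]
  nlinarith [Real.exp_one_lt_d9, Real.exp_pos 1]

/-- Uniform in `K` and `ξ`: `n_K ≥ 1 + γ ≥ 3/2` gives `ξ log n_K ≥ 1/6 ≥ exp (-2)`, and `-log γ ≥ 1
- γ`. -/
theorem max_staleRounds_le (hξ : 1 / 2 < ξ) (hγ : 1 / 2 ≤ γ) (hγ1 : γ < 1) {K : ℕ} (hK : 2 ≤ K) :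
    max (staleRounds ξ γ K) 0 ≤ (Real.log (1 / (1 - γ)) + 2) / (1 - γ) := by
  have he : 0 < 1 - γ := by linarith
  have hγ0 : 0 < γ := by linarith
  have hL : 0 ≤ Real.log (1 / (1 - γ)) := Real.log_nonneg (by
    rw [le_div_iff₀ he]; linarith)
  have hlγ := Real.log_le_sub_one_of_pos hγ0
  refine max_le ?_ (by positivity)
  have hn := one_add_le_discTotal hγ0 hγ1 hK
  have hlK : 1 / 3 ≤ Real.log (discTotal γ K) := by
    have h1 := Real.one_sub_inv_le_log_of_pos (show 0 < discTotal γ K by linarith)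
    have h2 : (discTotal γ K)⁻¹ ≤ 2 / 3 := by
      rw [inv_le_comm₀ (by linarith) (by norm_num)]
      linarith
    linarith
  have h6 : -2 ≤ Real.log (ξ * Real.log (discTotal γ K)) := by
    rw [Real.le_log_iff_exp_le (by positivity)]
    have h7 : Real.exp (-2) ≤ 1 / 6 := by
      rw [Real.exp_neg, inv_le_comm₀ (Real.exp_pos 2) (by norm_num),
        show (2 : ℝ) = 1 + 1 by norm_num, Real.exp_add]
      nlinarith [Real.exp_one_gt_d9]
    nlinarith
  have hw : -(Real.log (1 / (1 - γ)) + 2) ≤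
      Real.log ((1 - γ) * ξ * Real.log (discTotal γ K)) := by
    rw [mul_assoc, Real.log_mul he.ne' (by positivity), one_div, Real.log_inv]
    linarith
  rw [staleRounds, div_le_iff_of_neg (by linarith)]
  refine le_trans ?_ hw
  rw [div_mul_eq_mul_div, div_le_iff₀ he]
  nlinarith

end Tuning

variable {K : ℕ} {Ω : Type u} [MeasurableSpace Ω] {B ξ γ δ : ℝ} {X : ℕ → Fin K → Ω → ℝ}
  {I : ℕ → Ω → Fin K} {P : Measure Ω}

theorem numBreakpoints_lt {T : ℕ} (h : 1 ≤ numBreakpoints X P T) : numBreakpoints X P T < T := by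
  have h1 : numBreakpoints X P T ≤ (Finset.Ico 1 T).card := by
    classical exact Finset.card_filter_le _ _
  rw [Nat.card_Ico] at h1
  omega

/-- Constant of the bound for the tuned discount factor. -/
noncomputable def tunedConst (B ξ δ : ℝ) : ℝ :=
  B⁻¹ +
    (144 * B ^ 2 * ξ / δ ^ 2 * (2 * |Real.log (4 * B)| + 1) * ((4 * B)⁻¹ + 1) +
    4 * ((2 * |Real.log (4 * B)| + 1) / Real.log (1 + 4 * √(1 - 1 / (2 * ξ))) + 2) * (4 * B)⁻¹ +
    (2 * |Real.log (4 * B)| + 5) * (4 * B))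

theorem tunedConst_pos (hB : 0 < B) (hξ : 1 / 2 < ξ) : 0 < tunedConst B ξ δ := by
  have := log_one_add_four_mul_sqrt_pos hξ
  unfold tunedConst
  positivity

theorem integral_badPlays_le_of_tuned [IsProbabilityMeasure P] (hB : 0 < B) (hξ : 1 / 2 < ξ)
    (hδ : 0 < δ) {T : ℕ} (hK : 2 ≤ K) (hU : 1 ≤ numBreakpoints X P T)
    (hγ : γ = 1 - (4 * B)⁻¹ * √((numBreakpoints X P T : ℝ) / T)) (hγ0 : 0 < γ)
    (hE : IsEnvironment B X P) (hI : IsDUCB B ξ γ X I) (i : Fin K)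
    (hgap : ∀ t ∈ Finset.Icc 1 T, mean X P t i < bestMean X P t →
      δ ≤ bestMean X P t - mean X P t i) :
    ∫ ω, badPlays X P I T i ω ∂P ≤
      tunedConst B ξ δ * (√((T : ℝ) * numBreakpoints X P T) * Real.log T) := by
  have hUT := numBreakpoints_lt hU
  have hT2 : (2 : ℝ) ≤ T := by exact_mod_cast (by omega : 2 ≤ T)
  have hU1 : (1 : ℝ) ≤ numBreakpoints X P T := by exact_mod_cast hU
  generalize hUdef : (numBreakpoints X P T : ℝ) = U at *
  have hT0 : (0 : ℝ) < T := by linarith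
  have hU0 : 0 < U := by linarith
  have hlogT : 1 / 2 ≤ Real.log T := by
    have := Real.log_le_log (by norm_num) hT2
    linarith [Real.log_two_gt_d9]
  have heq : 1 - γ = (4 * B)⁻¹ * √(U / T) := by linarith
  have he : 0 < 1 - γ := by rw [heq]; positivity
  have hγ1 : γ < 1 := by linarith
  have hTe : T * (1 - γ) = (4 * B)⁻¹ * √(T * U) := by
    rw [heq, Real.sqrt_div hU0.le, Real.sqrt_mul hT0.le]
    have := Real.sq_sqrt hT0.le
    have hs : √(T : ℝ) ≠ 0 := by positivity
    field_simp
    linarith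
  have hUe : U / (1 - γ) = 4 * B * √(T * U) := by
    rw [heq, Real.sqrt_div hU0.le, Real.sqrt_mul hT0.le]
    have := Real.sq_sqrt hU0.le
    have hs : √(T : ℝ) ≠ 0 := by positivity
    have hs : √U ≠ 0 := by positivity
    field_simp
    linarith
  have hS : 1 ≤ √(T * U) := Real.one_le_sqrt.2 (by nlinarith)
  have hL := log_inv_le_of_tuned hB hU1 hT2
  rw [← heq] at hL
  have hL0 : 0 < Real.log (1 / (1 - γ)) := Real.log_pos (by rw [lt_div_iff₀ he]; linarith)
  have hlam := log_one_add_four_mul_sqrt_pos hξ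
  have hpart := integral_badPlays_le_constB_add_constC hK hB hξ hγ0 hγ1 (by omega : 1 ≤ T) hE hI i
  rw [hUdef, constC_mul hγ0 hγ1, constB_mul hγ0 hγ1 (by omega : 1 ≤ T)] at hpart
  unfold tunedConst
  set S := √(T * U)
  set c₀ := 2 * |Real.log (4 * B)| + 1 with hc₀
  have hc₀pos : 0 < c₀ := by positivity
  set lam := Real.log (1 + 4 * √(1 - 1 / (2 * ξ)))
  have hSl : 0 < S * Real.log T := by positivity
  have hrest : 0 ≤ 144 * B ^ 2 * ξ / δ ^ 2 * c₀ * ((4 * B)⁻¹ + 1) +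
    4 * (c₀ / lam + 2) * (4 * B)⁻¹ + (2 * |Real.log (4 * B)| + 5) * (4 * B) := by positivity
  -- If `1 - γ ≥ 1/2`, then `T ≤ 2 T (1 - γ) = √(T Υ) / (2 B)`, and the trivial bound `T` is covered
  -- by the summand `B⁻¹` of `tunedConst`.
  rcases le_or_gt (1 / 2) (1 - γ) with h | h
  · have h1 : ∫ ω, badPlays X P I T i ω ∂P ≤ ∫ _, (T : ℝ) ∂P :=
      integral_mono_of_nonneg (Filter.Eventually.of_forall (badPlays_nonneg T i))
        (integrable_const _) (Filter.Eventually.of_forall (badPlays_le T i))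
    rw [integral_const, probReal_univ, one_smul] at h1
    have h2 : (T : ℝ) ≤ B⁻¹ * (S * Real.log T) := by
      have h3 : (T : ℝ) / 2 ≤ (4 * B)⁻¹ * S := by rw [← hTe]; nlinarith
      have h4 : (T : ℝ) ≤ B⁻¹ * S * (1 / 2) := by
        rw [mul_inv] at h3; linarith
      calc (T : ℝ) ≤ B⁻¹ * S * (1 / 2) := h4
        _ ≤ B⁻¹ * S * Real.log T := by gcongr
        _ = _ := by ring
    nlinarith
  by_cases hbad : ∃ t ∈ Finset.Icc 1 T, mean X P t i < bestMean X P t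
  swap
  · simp only [badPlays_eq_zero hbad, integral_zero]
    positivity
  obtain ⟨t, ht, hlt⟩ := hbad
  obtain ⟨s, hs, hslt, hmin⟩ := exists_minGap_eq ht hlt
  have hΔ : δ ≤ minGap X P T i := by rw [hmin]; exact hgap s hs hslt
  have hG := one_ninth_le_rpow (by linarith : 1 / 2 ≤ γ) hγ1
  have hG' : γ ^ (1 / (1 - γ)) ≤ 1 / 2 := by
    refine (rpow_one_div_le hγ0 hγ1).trans ?_
    rw [Real.exp_neg, inv_le_comm₀ (Real.exp_pos 1) (by norm_num)]
    linarith [Real.exp_one_gt_d9]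
  have hstale := max_staleRounds_le hξ (by linarith : 1 / 2 ≤ γ) hγ1 hK
  rw [hTe] at hpart
  set L := Real.log (1 / (1 - γ))
  set G := γ ^ (1 / (1 - γ))
  -- The constant `144` is `16 * 9`, from `G ≥ 1/9`.
  have t1 : 16 * B ^ 2 * ξ * L / minGap X P T i ^ 2 / G * ⌈(4 * B)⁻¹ * S⌉ ≤
      144 * B ^ 2 * ξ / δ ^ 2 * c₀ * ((4 * B)⁻¹ + 1) * (S * Real.log T) := by
    have h1 : (⌈(4 * B)⁻¹ * S⌉ : ℝ) ≤ ((4 * B)⁻¹ + 1) * S := by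
      have := Int.ceil_lt_add_one ((4 * B)⁻¹ * S)
      linarith
    calc _ ≤ 16 * B ^ 2 * ξ * (c₀ * Real.log T) / δ ^ 2 / (1 / 9) * (((4 * B)⁻¹ + 1) * S) := by
          gcongr
      _ = _ := by ring
  have t2 : 2 * ⌈L / lam⌉ / (1 - G) * ((4 * B)⁻¹ * S) ≤
      4 * (c₀ / lam + 2) * (4 * B)⁻¹ * (S * Real.log T) := by
    have h1 : (⌈L / lam⌉ : ℝ) ≤ (c₀ / lam + 2) * Real.log T := by
      have h2 := Int.ceil_lt_add_one (L / lam)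
      have h3 : L / lam ≤ c₀ * Real.log T / lam := by gcongr
      rw [mul_div_right_comm] at h3
      linarith
    have hG1 : 1 / 2 ≤ 1 - G := by linarith
    calc _ ≤ 2 * ((c₀ / lam + 2) * Real.log T) / (1 / 2) * ((4 * B)⁻¹ * S) := by
          gcongr
      _ = _ := by ring
  have t3 : max (staleRounds ξ γ K) 0 * U ≤
      (2 * |Real.log (4 * B)| + 5) * (4 * B) * (S * Real.log T) := by
    calc _ ≤ (L + 2) / (1 - γ) * U := by gcongr
      _ = (L + 2) * (4 * B * S) := by rw [← hUe]; ring
      _ ≤ ((2 * |Real.log (4 * B)| + 5) * Real.log T) * (4 * B * S) := by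
          gcongr
          rw [hc₀] at hL
          linarith
      _ = _ := by ring
  have t0 : 0 ≤ B⁻¹ * (S * Real.log T) := by positivity
  linarith

end NonStatBandit

theorem mainTheorem1 :
    -- explicit bound on the expected number of plays of arm `i` while it is not optimal
    (∀ (K : ℕ) (B ξ γ : ℝ), 2 ≤ K → 0 < B → 1 / 2 < ξ → 0 < γ → γ < 1 →
      ∀ (Ω : Type u) [MeasurableSpace Ω] (P : Measure Ω) [IsProbabilityMeasure P]
        (X : ℕ → Fin K → Ω → ℝ) (I : ℕ → Ω → Fin K) (T : ℕ) (i : Fin K),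
        1 ≤ T → NonStatBandit.IsEnvironment B X P → NonStatBandit.IsDUCB B ξ γ X I →
        ∫ ω, NonStatBandit.badPlays X P I T i ω ∂P ≤
          NonStatBandit.constB B ξ γ T (NonStatBandit.minGap X P T i) *
              (T : ℝ) * (1 - γ) * Real.log (1 / (1 - γ)) +
            max (NonStatBandit.constC ξ γ K) 0 *
              ((NonStatBandit.numBreakpoints X P T : ℝ) / (1 - γ)) *
                Real.log (1 / (1 - γ))) ∧
    -- tuned discount factor
    (∀ (B ξ δ : ℝ), 0 < B → 1 / 2 < ξ → 0 < δ →
      ∃ C : ℝ, 0 < C ∧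
        ∀ (K : ℕ) (Ω : Type u) [MeasurableSpace Ω] (P : Measure Ω) [IsProbabilityMeasure P]
          (X : ℕ → Fin K → Ω → ℝ) (I : ℕ → Ω → Fin K) (T : ℕ) (γ : ℝ),
          2 ≤ K → 1 ≤ NonStatBandit.numBreakpoints X P T →
          γ = 1 - (4 * B)⁻¹ * √((NonStatBandit.numBreakpoints X P T : ℝ) / T) → 0 < γ →
          NonStatBandit.IsEnvironment B X P → NonStatBandit.IsDUCB B ξ γ X I →
          -- expected number of plays of an arm `i` whose gaps are at least `δ`
          (∀ i : Fin K,
            (∀ t ∈ Finset.Icc 1 T, NonStatBandit.mean X P t i < NonStatBandit.bestMean X P t →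
              δ ≤ NonStatBandit.bestMean X P t - NonStatBandit.mean X P t i) →
            ∫ ω, NonStatBandit.badPlays X P I T i ω ∂P ≤
              C * (√((T : ℝ) * NonStatBandit.numBreakpoints X P T) * Real.log T)) ∧
          -- expected regret, if the gaps of all arms are at least `δ`
          ((∀ i : Fin K, ∀ t ∈ Finset.Icc 1 T,
              NonStatBandit.mean X P t i < NonStatBandit.bestMean X P t →
              δ ≤ NonStatBandit.bestMean X P t - NonStatBandit.mean X P t i) →
            ∀ best : ℕ → Fin K,
              (∀ t ∈ Finset.Icc 1 T, ∀ j,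
                NonStatBandit.mean X P t j ≤ NonStatBandit.mean X P t (best t)) →
              NonStatBandit.regret X P I best T ≤
                C * K * (√((T : ℝ) * NonStatBandit.numBreakpoints X P T) * Real.log T))) := by
  refine ⟨fun K B ξ γ hK hB hξ hγ0 hγ1 Ω _ P _ X I T i hT hE hI =>
    NonStatBandit.integral_badPlays_le_constB_add_constC hK hB hξ hγ0 hγ1 hT hE hI i,
    fun B ξ δ hB hξ hδ => ?_⟩
  have hC := NonStatBandit.tunedConst_pos (δ := δ) hB hξ
  -- The factor `1 + B` serves both claims: `1` for the bad plays, `B` for the regret.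
  refine ⟨NonStatBandit.tunedConst B ξ δ * (1 + B), by positivity,
    fun K Ω _ P _ X I T γ hK hU hγ hγ0 hE hI => ?_⟩
  have hbad := NonStatBandit.integral_badPlays_le_of_tuned hB hξ hδ hK hU hγ hγ0 hE hI
  set c := NonStatBandit.tunedConst B ξ δ
  set y := √((T : ℝ) * NonStatBandit.numBreakpoints X P T) * Real.log T with hy
  have hy0 : 0 ≤ y := mul_nonneg (Real.sqrt_nonneg _) (Real.log_natCast_nonneg T)
  have hcy : 0 ≤ c * y := mul_nonneg hC.le hy0
  have hcyB : 0 ≤ c * y * B := mul_nonneg hcy hB.le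
  refine ⟨fun i hi => (hbad i hi).trans (by linarith), fun hgap best _ => ?_⟩
  calc NonStatBandit.regret X P I best T
      ≤ B * ∑ i, ∫ ω, NonStatBandit.badPlays X P I T i ω ∂P :=
        NonStatBandit.regret_le hE hI T best
    _ ≤ B * ∑ _i : Fin K, c * y := by
        gcongr with i
        exact hbad i (hgap i)
    _ = c * B * K * y := by
        rw [Finset.sum_const, Finset.card_univ, Fintype.card_fin, nsmul_eq_mul]
        ring
    _ ≤ c * (1 + B) * K * y := by
        gcongr
        linarith
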